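/- Let $\Lambda=M\mathbb Z^d$ be a full lattice in $\mathbb R^d$ ($M\in\mathbb R^{d\times d}$ invertible), with dual lattice $\Lambda^*=M^{-T}\mathbb Z^d$ and fundamental cell $\Pi_\Lambda=M[0,1)^d$. Let $\Omega\subset\mathbb R^d$ be a $k$-tile for $\Lambda$: $\Omega$ is Lebesgue measurable, $0<|\Omega|<\infty$, and $\sum_{l\in\Lambda}\chi_\Omega(x-l)=k$ for almost every $x\in\mathbb R^d$. Then $\Omega$ can be partitioned, up to a null set, into mutually disjoint measurable sets $\Omega_1,\dots,\Omega_k$, each of which is a fundamental domain of $\Lambda$ (up to null sets). Fix any such partition. For almost every $x\in\Pi_\Lambda$ and $1\le r\le k$ let $\lambda_r(x)\in\Lambda$ be the unique lattice point with $x+\lambda_r(x)\in\Omega_r$, let $\omega_r:\Pi_\Lambda\to\Omega_r$ be the (almost everywhere defined) bijection $\omega_r(x)=x+\lambda_r(x)$, and write $e_l(x)=e^{2\pi i\, l\cdot x}$. Suppose that there are vectors $a_1,\dots,a_k\in\mathbb R^d$ and constants $0<\alpha<\beta<\infty$ such that for almost every $x\in\Pi_\Lambda$ all singular values $\sigma_1,\dots,\sigma_k$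 of the $k\times k$ matrix $V(x)$ with entries $$V(x)_{sr}=e^{-2\pi i\,\lambda_r(x)\cdot a_s},\qquad 1\le s,r\le k,$$ satisfy $\alpha<\sigma_i(V(x))<\beta$. Let $L=\bigcup_{s=1}^k(\Lambda^*+a_s)$. Then the formula $$g_{\lambda^*+a_s}(x)=e_{\lambda^*+a_s}(x)\left(k\sum_{r=1}^k V(\omega_r^{-1}(x))_{sr}\,\bigl(V(\omega_r^{-1}(x))^{-1}\bigr)_{rs}\,\chi_{\Omega_r}(x)\right),\qquad \lambda^*\in\Lambda^*,\ 1\le s\le k,$$ determines a family $\{g_l\}_{l\in L}$ in $L^2(\Omega)$, and $\{e_l\}_{l\in L}$ and $\{g_l\}_{l\in L}$ are biorthogonal Riesz bases of $L^2(\Omega)$, that is, both are Riesz bases, $\langle e_l,g_l\rangle=|\Omega|$ for every $l\in L$, and $\langle e_l,g_{l'}\rangle=0$ for $l\ne l'$. Here $\{\varphi_l\}_{l\in L}\subset L^2(\Omega)$ is a Riesz basis if there are constants $0<A\le B<\infty$ such that every $f\in L^2(\Omega)$ has a unique expansion $f=\sum_{l\in L}c_l\varphi_l$ (unconditionally convergent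 in $L^2(\Omega)$) with $(c_l)\in\ell^2(L)$, and $A\|f\|^2\le\sum_l|c_l|^2\le B\|f\|^2$. -/

import Mathlib

open MeasureTheory
open scoped ENNReal Matrix

/-- The full lattice `M ℤ^d` generated by the columns of a matrix `M`
(it has full rank when `M.det ≠ 0`). -/
noncomputable def lattice {d : ℕ} (M : Matrix (Fin d) (Fin d) ℝ) :
    AddSubgroup (EuclideanSpace ℝ (Fin d)) where
  carrier := Set.range fun z : Fin d → ℤ =>
    (WithLp.toLp 2 (M *ᵥ fun i => (z i : ℝ)) : EuclideanSpace ℝ (Fin d))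
  zero_mem' := by
    refine ⟨0, ?_⟩
    have h : (fun i : Fin d => (((0 : Fin d → ℤ) i : ℤ) : ℝ)) = 0 := by
      ext i; simp
    simp only [h, Matrix.mulVec_zero, WithLp.toLp_zero]
  add_mem' := by
    rintro _ _ ⟨z, rfl⟩ ⟨w, rfl⟩
    refine ⟨z + w, ?_⟩
    have h : (fun i : Fin d => (((z + w) i : ℤ) : ℝ))
        = (fun i => (z i : ℝ)) + fun i => (w i : ℝ) := by
      ext i; simp
    simp only [h, Matrix.mulVec_add, WithLp.toLp_add]
  neg_mem' := by
    rintro _ ⟨z, rfl⟩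
    refine ⟨-z, ?_⟩
    have h : (fun i : Fin d => (((-z) i : ℤ) : ℝ)) = -(fun i => (z i : ℝ)) := by
      ext i; simp
    simp only [h, Matrix.mulVec_neg, WithLp.toLp_neg]

/-- The dual lattice `Λ* = M^{-T} ℤ^d` of `Λ = M ℤ^d`. -/
noncomputable def dualLattice {d : ℕ} (M : Matrix (Fin d) (Fin d) ℝ) :
    AddSubgroup (EuclideanSpace ℝ (Fin d)) :=
  lattice (M⁻¹)ᵀ

/-- The fundamental parallelepiped `Π_Λ = M [0,1)^d`. -/
def fundCell {d : ℕ} (M : Matrix (Fin d) (Fin d) ℝ) : Set (EuclideanSpace ℝ (Fin d)) :=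
  {x | ∃ t : Fin d → ℝ, (∀ i, t i ∈ Set.Ico (0 : ℝ) 1) ∧ x = WithLp.toLp 2 (M *ᵥ t)}

/-- `Ω` is a `k`-tile for `Λ = M ℤ^d`: it is Lebesgue measurable, of finite positive measure, and
`∑_{l ∈ Λ} χ_Ω(x - l) = k` for almost all `x`. -/
structure IsKTile {d : ℕ} (M : Matrix (Fin d) (Fin d) ℝ) (k : ℕ)
    (Ω : Set (EuclideanSpace ℝ (Fin d))) : Prop where
  nullMeasurableSet : NullMeasurableSet Ω volume
  volume_pos : 0 < volume Ω
  volume_lt_top : volume Ω < ∞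
  tiles : ∀ᵐ x ∂(volume : Measure (EuclideanSpace ℝ (Fin d))),
    ∑' l : lattice M, Ω.indicator (fun _ => (1 : ℝ≥0∞)) (x - l) = k

/-- `Ω = Ω_1 ∪ ⋯ ∪ Ω_k ∪ E`, where `E` is a null set and the `Ω_r` are mutually disjoint Lebesgue
measurable sets, each of which is a fundamental domain of `Λ = M ℤ^d`. -/
structure IsTilePartition {d : ℕ} (M : Matrix (Fin d) (Fin d) ℝ) {k : ℕ}
    (Ω : Set (EuclideanSpace ℝ (Fin d))) (P : Fin k → Set (EuclideanSpace ℝ (Fin d))) : Prop where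
  subset : ∀ r, P r ⊆ Ω
  pairwise_disjoint : Pairwise fun r r' => Disjoint (P r) (P r')
  volume_diff : volume (Ω \ ⋃ r, P r) = 0
  isAddFundamentalDomain : ∀ r, IsAddFundamentalDomain (lattice M) (P r) volume

open Classical in
/-- For a fundamental domain `D` of `Λ = M ℤ^d`, the lattice point `λ(x)` with `x + λ(x) ∈ D`;
it exists and is unique for almost every `x` (and the value is `0` where there is none). -/
noncomputable def latticePoint {d : ℕ} (M : Matrix (Fin d) (Fin d) ℝ)
    (D : Set (EuclideanSpace ℝ (Fin d))) (x : EuclideanSpace ℝ (Fin d)) :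
    EuclideanSpace ℝ (Fin d) :=
  if h : ∃ l ∈ lattice M, x + l ∈ D then h.choose else 0

/-- The map `ω : Π_Λ → D`, `x ↦ x + λ(x)`. -/
noncomputable def omega {d : ℕ} (M : Matrix (Fin d) (Fin d) ℝ)
    (D : Set (EuclideanSpace ℝ (Fin d))) (x : EuclideanSpace ℝ (Fin d)) :
    EuclideanSpace ℝ (Fin d) :=
  x + latticePoint M D x

/-- The inverse `ω⁻¹ : D → Π_Λ`. -/
noncomputable def omegaInv {d : ℕ} (M : Matrix (Fin d) (Fin d) ℝ)
    (D : Set (EuclideanSpace ℝ (Fin d))) :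
    EuclideanSpace ℝ (Fin d) → EuclideanSpace ℝ (Fin d) :=
  Function.invFunOn (omega M D) (fundCell M)

/-- The exponential `e_l(x) = e^{2π i l · x}`. -/
noncomputable def expFun {d : ℕ} (l x : EuclideanSpace ℝ (Fin d)) : ℂ :=
  Complex.exp (2 * Real.pi * Complex.I * (inner ℝ l x : ℝ))

/-- The matrix `V(x)` with entries `V(x)_{sr} = e^{-2π i λ_r(x) · a_s}`. -/
noncomputable def matV {d k : ℕ} (M : Matrix (Fin d) (Fin d) ℝ)
    (P : Fin k → Set (EuclideanSpace ℝ (Fin d))) (a : Fin k → EuclideanSpace ℝ (Fin d))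
    (x : EuclideanSpace ℝ (Fin d)) : Matrix (Fin k) (Fin k) ℂ :=
  Matrix.of fun s r =>
    Complex.exp (-(2 * Real.pi * Complex.I * (inner ℝ (latticePoint M (P r) x) (a s) : ℝ)))

/-- The frequency set `L = ⋃_s (Λ* + a_s)`. -/
def freqSet {d k : ℕ} (M : Matrix (Fin d) (Fin d) ℝ) (a : Fin k → EuclideanSpace ℝ (Fin d)) :
    Set (EuclideanSpace ℝ (Fin d)) :=
  ⋃ s, {l | ∃ u ∈ dualLattice M, l = u + a s}

/-- The function
`e_{u + a_s}(y) · (k ∑_r V(ω_r⁻¹(y))_{sr} (V(ω_r⁻¹(y))⁻¹)_{rs} χ_{Ω_r}(y))`. -/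
noncomputable def dualFun {d k : ℕ} (M : Matrix (Fin d) (Fin d) ℝ)
    (P : Fin k → Set (EuclideanSpace ℝ (Fin d))) (a : Fin k → EuclideanSpace ℝ (Fin d))
    (u : EuclideanSpace ℝ (Fin d)) (s : Fin k) (y : EuclideanSpace ℝ (Fin d)) : ℂ :=
  expFun (u + a s) y * (k * ∑ r, matV M P a (omegaInv M (P r) y) s r *
    (matV M P a (omegaInv M (P r) y))⁻¹ r s * (P r).indicator (fun _ => (1 : ℂ)) y)

/-- Riesz bases of a Hilbert space: every `f` has a unique expansion `f = ∑ c_l φ_l` with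
`c ∈ ℓ²`, and `A ‖f‖² ≤ ∑ |c_l|² ≤ B ‖f‖²` for some constants `0 < A ≤ B < ∞`. -/
def IsRieszBasis {ι H : Type*} [NormedAddCommGroup H] [InnerProductSpace ℂ H] (φ : ι → H) :
    Prop :=
  ∃ A B : ℝ, 0 < A ∧ A ≤ B ∧ ∀ f : H,
    ∃ c : lp (fun _ : ι => ℂ) 2,
      HasSum (fun l => c l • φ l) f ∧
      (∀ c' : lp (fun _ : ι => ℂ) 2, HasSum (fun l => c' l • φ l) f → c' = c) ∧
      A * ‖f‖ ^ 2 ≤ ∑' l, ‖c l‖ ^ 2 ∧ ∑' l, ‖c l‖ ^ 2 ≤ B * ‖f‖ ^ 2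

/-! Each `ω_r` carries Lebesgue measure on the cell `Π` to Lebesgue measure on `Ω_r`, so `f ↦ (f ∘
ω_r)_r` identifies `L²(Ω)` with `L²(Π)^k`. Since `e_u` is `Λ`-periodic for `u ∈ Λ*`, the exponential
with frequency `u + a_s` becomes `e_u(x)` times the vector `m_s(x) = (e_{a_s}(x) conj V(x)_{sr})_r`.
The dual function becomes `e_u(x)` times `m'_s(x) = (k e_{a_s}(x) (V(x)⁻¹)_{rs})_r`, because the
factor `V_{sr}` in its formula cancels the unimodular `conj V_{sr}` (`expFun_omega`,
`dualFun_omega`).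

Hence pairing `f` with either family gives, for fixed `s`, the Fourier coefficients of one function
on `Π` (`inner_eq_integral_modulatedSum`), and Parseval on the cell (`hasSum_fundCell`) applies.
Boundedness of `m` and `m'` makes both families Bessel: `|V_{sr}| = 1`, and the lower bound on the
singular values bounds the entries of `V⁻¹` by `α⁻¹`. The identity `V V⁻¹ = 1` gives biorthogonality
with constant `k |det M| = |Ω|`, and `V⁻¹ V = 1` gives completeness of the exponentials. Two
biorthogonal Bessel families, one of them complete, are Riesz bases
(`isRieszBasis_of_biorthogonal`).

The partition exists because almost every orbit meets `Ω` in `k` points: a translation invariant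
order on `Λ` ranks them, and `Ω_r` collects the points of rank `r`. -/

/-! ### Biorthogonal Bessel families in a Hilbert space. -/

section RieszBasis

variable {ι H : Type*} [NormedAddCommGroup H] [InnerProductSpace ℂ H]

/-- A family `φ` is a Bessel sequence with bound `B`. -/
def IsBesselWith (φ : ι → H) (B : ℝ) : Prop :=
  ∀ (f : H) (S : Finset ι), ∑ i ∈ S, ‖inner ℂ (φ i) f‖ ^ 2 ≤ B * ‖f‖ ^ 2

theorem IsBesselWith.comp_equiv {κ : Type*} {φ : ι → H} {B : ℝ} (h : IsBesselWith φ B)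
    (σ : κ ≃ ι) : IsBesselWith (φ ∘ σ) B := fun f S => by
  simpa [Finset.sum_map] using h f (S.map σ.toEmbedding)

theorem IsBesselWith.memℓp {φ : ι → H} {B : ℝ} (h : IsBesselWith φ B) (f : H) :
    Memℓp (fun i => inner ℂ (φ i) f) 2 := by
  refine memℓp_gen' (C := B * ‖f‖ ^ 2) fun S => ?_
  simpa using h f S

/-- The analysis operator `f ↦ (⟨φ_i, f⟩)_i` of a Bessel sequence. -/
noncomputable def IsBesselWith.analysis {φ : ι → H} {B : ℝ} (h : IsBesselWith φ B) :
    H →L[ℂ] lp (fun _ : ι => ℂ) 2 :=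
  LinearMap.mkContinuous
    { toFun := fun f => ⟨fun i => inner ℂ (φ i) f, h.memℓp f⟩
      map_add' := fun f g => by ext i; exact inner_add_right _ _ _
      map_smul' := fun c f => by ext i; exact inner_smul_right _ _ _ }
    (Real.sqrt |B|) fun f => by
      refine le_of_sq_le_sq ?_ (by positivity)
      rw [mul_pow, Real.sq_sqrt (abs_nonneg B)]
      have h1 := lp.norm_rpow_eq_tsum (p := 2) (by simp)
        (⟨fun i => inner ℂ (φ i) f, h.memℓp f⟩ : lp (fun _ : ι => ℂ) 2)
      simp only [ENNReal.toReal_ofNat, Real.rpow_ofNat] at h1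
      simp only [LinearMap.coe_mk, AddHom.coe_mk]
      rw [h1]
      refine Real.tsum_le_of_sum_le (fun i => by positivity) fun S => (h f S).trans ?_
      gcongr
      exact le_abs_self B

@[simp]
theorem IsBesselWith.analysis_apply {φ : ι → H} {B : ℝ} (h : IsBesselWith φ B) (f : H) (i : ι) :
    h.analysis f i = inner ℂ (φ i) f := rfl

variable [CompleteSpace H]

/-- The synthesis operator `c ↦ ∑ c_i φ_i` of a Bessel sequence. -/
noncomputable def IsBesselWith.synthesis {φ : ι → H} {B : ℝ} (h : IsBesselWith φ B) :
    lp (fun _ : ι => ℂ) 2 →L[ℂ] H :=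
  ContinuousLinearMap.adjoint h.analysis

theorem IsBesselWith.synthesis_single [DecidableEq ι] {φ : ι → H} {B : ℝ} (h : IsBesselWith φ B)
    (i : ι) (z : ℂ) : h.synthesis (lp.single 2 i z) = z • φ i := by
  refine ext_inner_right ℂ fun f => ?_
  rw [IsBesselWith.synthesis, ContinuousLinearMap.adjoint_inner_left, lp.inner_single_left,
    inner_smul_left]
  simp [mul_comm]

theorem IsBesselWith.hasSum_synthesis {φ : ι → H} {B : ℝ} (h : IsBesselWith φ B)
    (c : lp (fun _ : ι => ℂ) 2) : HasSum (fun i => c i • φ i) (h.synthesis c) := by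
  classical
  have h1 := (lp.hasSum_single (by simp) c).mapL h.synthesis
  simpa only [h.synthesis_single] using h1

/-- If synthesis with `e` and analysis with `g` are mutually inverse up to a nonzero constant, then
`e` is a Riesz basis, with expansion coefficients given by the inner products with `g`. -/
theorem isRieszBasis_of_synthesis_analysis {e g : ι → H} {Be Bg : ℝ} {C : ℝ} (hC : C ≠ 0)
    (he : IsBesselWith e Be) (hg : IsBesselWith g Bg)
    (hst : ∀ c, hg.analysis (he.synthesis c) = (C : ℂ) • c)
    (hts : ∀ f, he.synthesis (hg.analysis f) = (C : ℂ) • f) : IsRieszBasis e := by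
  have hC' : (C : ℂ) ≠ 0 := by exact_mod_cast hC
  have hnorm (c : lp (fun _ : ι => ℂ) 2) : ∑' i, ‖c i‖ ^ 2 = ‖c‖ ^ 2 := by
    have h1 := lp.norm_rpow_eq_tsum (p := 2) (by simp) c
    simp only [ENNReal.toReal_ofNat, Real.rpow_ofNat] at h1
    exact h1.symm
  -- The `+ 1` keeps `A` positive even if synthesis is zero; the `max` below secures `A ≤ B`.
  set A : ℝ := (‖he.synthesis‖ ^ 2 + 1)⁻¹
  have hA : 0 < A := by positivity
  refine ⟨A, max A ((‖(C : ℂ)‖⁻¹ * ‖hg.analysis‖) ^ 2), hA, le_max_left _ _, fun f => ?_⟩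
  refine ⟨(C : ℂ)⁻¹ • hg.analysis f, ?_, ?_, ?_, ?_⟩
  · convert! he.hasSum_synthesis ((C : ℂ)⁻¹ • hg.analysis f)
    rw [map_smul, hts, inv_smul_smul₀ hC']
  · intro c' hc'
    have h1 := hc'.unique (he.hasSum_synthesis c')
    rw [h1, hst, inv_smul_smul₀ hC']
  · rw [hnorm]
    set c := (C : ℂ)⁻¹ • hg.analysis f
    have hf : f = he.synthesis c := by rw [map_smul, hts, inv_smul_smul₀ hC']
    have h1 : ‖f‖ ^ 2 ≤ (‖he.synthesis‖ ^ 2 + 1) * ‖c‖ ^ 2 := by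
      have h2 : ‖f‖ ≤ ‖he.synthesis‖ * ‖c‖ := by
        rw [hf]; exact he.synthesis.le_opNorm c
      calc ‖f‖ ^ 2 ≤ (‖he.synthesis‖ * ‖c‖) ^ 2 := by gcongr
        _ ≤ _ := by nlinarith [sq_nonneg ‖c‖]
    rw [inv_mul_le_iff₀ (by positivity)]
    exact h1
  · rw [hnorm, norm_smul, norm_inv]
    calc (‖(C : ℂ)‖⁻¹ * ‖hg.analysis f‖) ^ 2
        ≤ (‖(C : ℂ)‖⁻¹ * (‖hg.analysis‖ * ‖f‖)) ^ 2 := by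
          gcongr; exact hg.analysis.le_opNorm f
      _ = (‖(C : ℂ)‖⁻¹ * ‖hg.analysis‖) ^ 2 * ‖f‖ ^ 2 := by ring
      _ ≤ _ := by gcongr; exact le_max_right _ _

/-- Pairing the series `∑ c_j e_j` term by term with `g_i` leaves only the `i`-th term. -/
theorem IsBesselWith.analysis_synthesis {e g : ι → H} {Be Bg : ℝ} {C : ℝ}
    (he : IsBesselWith e Be) (hg : IsBesselWith g Bg)
    (hd : ∀ i, inner ℂ (g i) (e i) = (C : ℂ)) (ho : ∀ i j, i ≠ j → inner ℂ (g i) (e j) = 0)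
    (c : lp (fun _ : ι => ℂ) 2) : hg.analysis (he.synthesis c) = (C : ℂ) • c := by
  ext i
  rw [hg.analysis_apply]
  have h1 := (he.hasSum_synthesis c).mapL (innerSL ℂ (g i))
  have h2 := hasSum_single (f := fun j => innerSL ℂ (g i) (c j • e j)) i
    (fun j hj => by simp [ho i j hj.symm])
  refine (h1.unique h2).trans ?_
  change innerSL ℂ (g i) (c i • e i) = (C : ℂ) * c i
  simp [hd, mul_comm]

/-- Two biorthogonal Bessel sequences, one of which is complete, are both Riesz bases. -/
theorem isRieszBasis_of_biorthogonal {e g : ι → H} {Be Bg : ℝ} {C : ℝ} (hC : C ≠ 0)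
    (he : IsBesselWith e Be) (hg : IsBesselWith g Bg)
    (hd : ∀ i, inner ℂ (e i) (g i) = (C : ℂ)) (ho : ∀ i j, i ≠ j → inner ℂ (e i) (g j) = 0)
    (hcomplete : ∀ f, (∀ i, inner ℂ (e i) f = 0) → f = 0) :
    IsRieszBasis e ∧ IsRieszBasis g := by
  have hge := hg.analysis_synthesis he hd ho
  have heg := he.analysis_synthesis hg
    (fun i => by rw [← inner_conj_symm, hd, Complex.conj_ofReal])
    (fun i j hij => by rw [← inner_conj_symm, ho j i hij.symm, map_zero])
  -- Analysis with `e` agrees on both sides, and it is injective by completeness.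
  have hgr (f : H) : hg.synthesis (he.analysis f) = (C : ℂ) • f := by
    refine sub_eq_zero.mp (hcomplete _ fun i => ?_)
    rw [← he.analysis_apply, map_sub, hge, map_smul, sub_self]
    rfl
  -- This is the adjoint of the identity `hgr`; `C` is real.
  have her (f : H) : he.synthesis (hg.analysis f) = (C : ℂ) • f := by
    refine ext_inner_right ℂ fun x => ?_
    rw [IsBesselWith.synthesis, ContinuousLinearMap.adjoint_inner_left,
      ← ContinuousLinearMap.adjoint_inner_right]
    change inner ℂ f (hg.synthesis _) = _
    rw [hgr, inner_smul_left, inner_smul_right, Complex.conj_ofReal]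
  exact ⟨isRieszBasis_of_synthesis_analysis hC he hg heg her,
    isRieszBasis_of_synthesis_analysis hC hg he hge hgr⟩

end RieszBasis

/-! ### Existence of the partition, by ranking lattice orbits. -/

section Existence

/-- The rank is strictly increasing on `S`, so it injects `S` into `range S.card`, and counting
makes this a bijection. -/
theorem Finset.existsUnique_card_filter_lt {α : Type*} [LinearOrder α] (S : Finset α) {r : ℕ}
    (hr : r < S.card) : ∃! l, l ∈ S ∧ (S.filter (· < l)).card = r := by
  have hmono : ∀ l ∈ S, ∀ m ∈ S, l < m → (S.filter (· < l)).card < (S.filter (· < m)).card := by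
    intro l hl m hm hlm
    refine Finset.card_lt_card ⟨fun x hx => ?_, fun h => ?_⟩
    · simp only [Finset.mem_filter] at hx ⊢
      exact ⟨hx.1, hx.2.trans hlm⟩
    · have := h (Finset.mem_filter.mpr ⟨hl, hlm⟩)
      simp at this
  have hinj : Set.InjOn (fun l => (S.filter (· < l)).card) S := by
    intro l hl m hm h
    rcases lt_trichotomy l m with h1 | h1 | h1
    · exact absurd h (hmono l hl m hm h1).ne
    · exact h1
    · exact absurd h (hmono m hm l hl h1).ne'
  have himg : S.image (fun l => (S.filter (· < l)).card) = Finset.range S.card := by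
    refine Finset.eq_of_subset_of_card_le (fun n hn => ?_) ?_
    · obtain ⟨l, hl, rfl⟩ := Finset.mem_image.mp hn
      rw [Finset.mem_range]
      refine Finset.card_lt_card ⟨Finset.filter_subset _ _, fun h => ?_⟩
      have := h hl
      simp at this
    · rw [Finset.card_range, Finset.card_image_of_injOn hinj]
  have hr' : r ∈ S.image (fun l => (S.filter (· < l)).card) := by
    rw [himg]; exact Finset.mem_range.mpr hr
  obtain ⟨l, hl, hlr⟩ := Finset.mem_image.mp hr'
  exact ⟨l, ⟨hl, hlr⟩, fun m hm => hinj hm.1 hl (hm.2.trans hlr.symm)⟩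

theorem Set.existsUnique_encard_lt {α : Type*} [LinearOrder α] {S : Set α} {k r : ℕ}
    (hS : S.encard = k) (hr : r < k) : ∃! l, l ∈ S ∧ {m ∈ S | m < l}.encard = r := by
  have hfin : S.Finite := Set.finite_of_encard_eq_coe hS
  lift S to Finset α using hfin
  rw [Set.encard_coe_eq_coe_finsetCard] at hS
  have hS' : S.card = k := by exact_mod_cast hS
  have h1 (l : α) : {m ∈ (S : Set α) | m < l}.encard = ((S.filter (· < l)).card : ℕ∞) := by
    rw [← Set.encard_coe_eq_coe_finsetCard]; congr 1; ext; simp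
  obtain ⟨l, hl, hl'⟩ := S.existsUnique_card_filter_lt (hS'.symm ▸ hr)
  refine ⟨l, ⟨hl.1, (h1 l).trans (by rw [hl.2])⟩, fun m hm => hl' m ⟨hm.1, ?_⟩⟩
  exact_mod_cast (h1 m).symm.trans hm.2

variable {d : ℕ}

instance lattice.countable (M : Matrix (Fin d) (Fin d) ℝ) : Countable (lattice M) :=
  (Set.countable_range _).to_subtype

/-- The lexicographic order, a translation invariant linear order on a lattice. -/
noncomputable abbrev latticeLexOrder (M : Matrix (Fin d) (Fin d) ℝ) : LinearOrder (lattice M) :=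
  LinearOrder.lift' (fun l => toLex (WithLp.ofLp (l : EuclideanSpace ℝ (Fin d)))) (by
    intro l m h
    exact Subtype.ext (WithLp.ofLp_injective 2 (toLex.injective h)))

theorem latticeLexOrder_add_lt_iff (M : Matrix (Fin d) (Fin d) ℝ) (a l : lattice M) :
    (latticeLexOrder M).lt (a + l) l ↔ (latticeLexOrder M).lt a 0 := by
  change toLex (WithLp.ofLp ((a : EuclideanSpace ℝ (Fin d)) + (l : EuclideanSpace ℝ (Fin d)))) <
    toLex (WithLp.ofLp _) ↔
    toLex (WithLp.ofLp (a : EuclideanSpace ℝ (Fin d))) < toLex (WithLp.ofLp _)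
  simp

/-- The points of `Ω` that have exactly `r` predecessors in `Ω` among their lattice translates. -/
def tilePiece (M : Matrix (Fin d) (Fin d) ℝ) (Ω : Set (EuclideanSpace ℝ (Fin d))) (r : ℕ) :
    Set (EuclideanSpace ℝ (Fin d)) :=
  {x ∈ Ω | {l : lattice M |
    (latticeLexOrder M).lt l 0 ∧ x + (l : EuclideanSpace ℝ (Fin d)) ∈ Ω}.encard = r}

variable (M : Matrix (Fin d) (Fin d) ℝ) {Ω : Set (EuclideanSpace ℝ (Fin d))}

/-- By translation invariance of the order, the negative lattice vectors that keep `x + l` in `Ω`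
correspond to the predecessors of `l` in the orbit of `x`. Finding the translate of `x` in the piece
thus becomes finding the element of rank `r`. -/
theorem add_mem_tilePiece_iff (x : EuclideanSpace ℝ (Fin d)) (l : lattice M) (r : ℕ) :
    x + (l : EuclideanSpace ℝ (Fin d)) ∈ tilePiece M Ω r ↔
      l ∈ {l : lattice M | x + (l : EuclideanSpace ℝ (Fin d)) ∈ Ω} ∧
      {m ∈ {l : lattice M | x + (l : EuclideanSpace ℝ (Fin d)) ∈ Ω} |
        (latticeLexOrder M).lt m l}.encard = r := by
  have h : {m ∈ {l : lattice M | x + (l : EuclideanSpace ℝ (Fin d)) ∈ Ω} |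
      (latticeLexOrder M).lt m l} =
      Equiv.addRight l '' {a : lattice M | (latticeLexOrder M).lt a 0 ∧
        x + (l : EuclideanSpace ℝ (Fin d)) + (a : EuclideanSpace ℝ (Fin d)) ∈ Ω} := by
    ext m
    rw [Equiv.image_eq_preimage_symm]
    have h1 := latticeLexOrder_add_lt_iff M (m - l) l
    rw [sub_add_cancel] at h1
    simp only [Set.mem_ofPred_eq, Set.mem_preimage, Equiv.addRight_symm, Equiv.coe_addRight,
      ← sub_eq_add_neg, h1, AddSubgroup.coe_sub]
    rw [add_add_sub_cancel, and_comm]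
  rw [h, (Equiv.addRight l).injective.encard_image]
  rfl

theorem tsum_indicator_one_eq_encard {α : Type*} (S : Set α) :
    ∑' a, S.indicator (fun _ => (1 : ℝ≥0∞)) a = S.encard := by
  rw [← tsum_subtype S, ENNReal.tsum_set_one]

/-- The number of predecessors is a countable sum of indicators of translates of `Ω`, and the piece
is one of its level sets in `Ω`. -/
theorem nullMeasurableSet_tilePiece (hΩ : NullMeasurableSet Ω volume) (r : ℕ) :
    NullMeasurableSet (tilePiece M Ω r) volume := by
  refine hΩ.inter ?_
  have h : AEMeasurable (fun x : EuclideanSpace ℝ (Fin d) => ∑' l : lattice M,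
      {l : lattice M | (latticeLexOrder M).lt l 0 ∧ x + (l : EuclideanSpace ℝ (Fin d)) ∈ Ω}.indicator
        (fun _ => (1 : ℝ≥0∞)) l) volume := by
    refine AEMeasurable.tsum fun l => ?_
    by_cases hl : (latticeLexOrder M).lt l 0
    · have h1 : NullMeasurableSet
          ((fun x : EuclideanSpace ℝ (Fin d) => x + (l : EuclideanSpace ℝ (Fin d))) ⁻¹' Ω) volume :=
        hΩ.preimage (measurePreserving_add_right volume _).quasiMeasurePreserving
      refine (aemeasurable_const (b := (1 : ℝ≥0∞)).indicator₀ h1).congr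
        (.of_forall fun x => ?_)
      have h2 : l ∈ {l : lattice M |
          (latticeLexOrder M).lt l 0 ∧ x + (l : EuclideanSpace ℝ (Fin d)) ∈ Ω} ↔
          x ∈ (fun x : EuclideanSpace ℝ (Fin d) => x + (l : EuclideanSpace ℝ (Fin d))) ⁻¹' Ω :=
        and_iff_right hl
      beta_reduce
      by_cases hx :
          x ∈ (fun x : EuclideanSpace ℝ (Fin d) => x + (l : EuclideanSpace ℝ (Fin d))) ⁻¹' Ω
      · rw [Set.indicator_of_mem hx, Set.indicator_of_mem (h2.mpr hx)]
      · rw [Set.indicator_of_notMem hx, Set.indicator_of_notMem (mt h2.mp hx)]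
    · refine (aemeasurable_const (b := (0 : ℝ≥0∞))).congr (.of_forall fun x => ?_)
      simp [Set.indicator, hl]
  refine (h.nullMeasurable (measurableSet_singleton (r : ℝ≥0∞))).congr (.of_eq ?_)
  ext x
  change (∑' l : lattice M, Set.indicator _ _ l) = (r : ℝ≥0∞) ↔ Set.encard _ = (r : ℕ∞)
  rw [tsum_indicator_one_eq_encard, ← ENat.toENNReal_coe, ENat.toENNReal_inj]

theorem IsKTile.ae_encard_eq {k : ℕ} (hΩ : IsKTile M k Ω) :
    ∀ᵐ x ∂(volume : Measure (EuclideanSpace ℝ (Fin d))),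
      {l : lattice M | x + (l : EuclideanSpace ℝ (Fin d)) ∈ Ω}.encard = k := by
  filter_upwards [hΩ.tiles] with x hx
  rw [← ENat.toENNReal_inj, ENat.toENNReal_coe, ← hx, ← tsum_indicator_one_eq_encard,
    ← (Equiv.neg (lattice M)).tsum_eq]
  refine tsum_congr fun l => ?_
  rw [sub_eq_add_neg]
  rfl

open scoped Pointwise in
theorem IsKTile.exists_isTilePartition {k : ℕ} (hΩ : IsKTile M k Ω) :
    ∃ P : Fin k → Set (EuclideanSpace ℝ (Fin d)), IsTilePartition M Ω P := by
  let := latticeLexOrder M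
  have hunique {x : EuclideanSpace ℝ (Fin d)}
      (hx : {l : lattice M | x + (l : EuclideanSpace ℝ (Fin d)) ∈ Ω}.encard = k)
      (r : Fin k) : ∃! l : lattice M, x + (l : EuclideanSpace ℝ (Fin d)) ∈ tilePiece M Ω r := by
    simp only [add_mem_tilePiece_iff]
    exact Set.existsUnique_encard_lt hx r.2
  refine ⟨fun r => tilePiece M Ω r, fun r x hx => hx.1, ?_, ?_, fun r => ⟨?_, ?_, ?_⟩⟩
  · intro r r' hrr'
    refine Set.disjoint_left.mpr fun x hx hx' => hrr' (Fin.ext ?_)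
    have h := hx.2.symm.trans hx'.2
    exact_mod_cast h
  · rw [measure_eq_zero_iff_ae_notMem]
    filter_upwards [hΩ.ae_encard_eq] with x hx hxΩ
    refine hxΩ.2 ?_
    -- As `x ∈ Ω`, the vector `0` belongs to the orbit set but is not its own predecessor, so `x`
    -- has fewer than `k` predecessors.
    have hsub : {l : lattice M |
        (latticeLexOrder M).lt l 0 ∧ x + (l : EuclideanSpace ℝ (Fin d)) ∈ Ω} ⊂
        {l : lattice M | x + (l : EuclideanSpace ℝ (Fin d)) ∈ Ω} := by
      refine ⟨fun l hl => hl.2, fun h => ?_⟩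
      have h0 := h (a := 0) (by simpa using hxΩ.1)
      exact lt_irrefl (0 : lattice M) h0.1
    have hlt := ((Set.finite_of_encard_eq_coe hx).subset hsub.1).encard_lt_encard hsub
    rw [hx] at hlt
    obtain ⟨r, hr⟩ := ENat.ne_top_iff_exists.mp hlt.ne_top
    rw [← hr] at hlt
    exact Set.mem_iUnion.mpr ⟨⟨r, by exact_mod_cast hlt⟩, hxΩ.1, hr.symm⟩
  · exact nullMeasurableSet_tilePiece M hΩ.nullMeasurableSet r
  · filter_upwards [hΩ.ae_encard_eq] with x hx
    obtain ⟨l, hl, -⟩ := hunique hx r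
    exact ⟨l, by rwa [AddSubgroup.vadd_def, vadd_eq_add, add_comm]⟩
  · intro g g' hgg'
    change volume _ = 0
    rw [measure_eq_zero_iff_ae_notMem]
    filter_upwards [hΩ.ae_encard_eq] with x hx hxg
    have hmem {g : lattice M} (h : x ∈ g +ᵥ tilePiece M Ω r) :
        x + ((-g : lattice M) : EuclideanSpace ℝ (Fin d)) ∈ tilePiece M Ω r := by
      obtain ⟨y, hy, rfl⟩ := h
      simpa [AddSubgroup.vadd_def, add_comm] using hy
    exact hgg' (neg_injective ((hunique hx r).unique (hmem hxg.1) (hmem hxg.2)))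

end Existence

/-! ### Parseval's identity on the fundamental cell. -/

section FourierCell

/-- The measure on the unit circle underlying the multivariate Fourier series of Mathlib. -/
noncomputable local instance : MeasureSpace UnitAddCircle := ⟨AddCircle.haarAddCircle⟩

local instance : Measure.IsAddHaarMeasure (volume : Measure UnitAddCircle) :=
  inferInstanceAs (Measure.IsAddHaarMeasure AddCircle.haarAddCircle)

local instance : IsProbabilityMeasure (volume : Measure UnitAddCircle) :=
  inferInstanceAs (IsProbabilityMeasure AddCircle.haarAddCircle)

variable {d : ℕ}

/-- The half open unit cube `[0,1)^d`. -/
def unitCube (d : ℕ) : Set (Fin d → ℝ) := Set.univ.pi fun _ => Set.Ico 0 1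

theorem measurableSet_unitCube : MeasurableSet (unitCube d) :=
  MeasurableSet.univ_pi fun _ => measurableSet_Ico

/-- The torus is parametrized by `(0,1]^d`, whereas the cell is the image of `[0,1)^d`. -/
theorem unitCube_ae_eq :
    {x : Fin d → ℝ | ∀ i, x i ∈ Set.Ioc ((0 : Fin d → ℝ) i) ((0 : Fin d → ℝ) i + 1)} =ᵐ[volume]
      unitCube d := by
  have h1 := Measure.univ_pi_Ioc_ae_eq_Icc (μ := fun _ : Fin d => (volume : Measure ℝ))
    (f := fun _ => 0) (g := fun _ => 1)
  have h2 := Measure.univ_pi_Ico_ae_eq_Icc (μ := fun _ : Fin d => (volume : Measure ℝ))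
    (f := fun _ => 0) (g := fun _ => 1)
  have h3 : {x : Fin d → ℝ | ∀ i, x i ∈ Set.Ioc ((0 : Fin d → ℝ) i) ((0 : Fin d → ℝ) i + 1)} =
      Set.univ.pi fun _ => Set.Ioc 0 1 := by ext; simp [Set.mem_pi]
  rw [h3]
  exact h1.trans h2.symm

theorem mFourier_coe (n : Fin d → ℤ) (x : Fin d → ℝ) :
    UnitAddTorus.mFourier n (fun i => (x i : UnitAddCircle)) =
      Complex.exp (2 * Real.pi * Complex.I * (((fun i => (n i : ℝ)) ⬝ᵥ x : ℝ) : ℂ)) := by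
  simp only [UnitAddTorus.mFourier, ContinuousMap.coe_mk, fourier_coe_apply, ← Complex.exp_sum,
    dotProduct]
  congr 1
  push_cast
  rw [Finset.mul_sum]
  refine Finset.sum_congr rfl fun i _ => ?_
  ring

theorem integral_mFourier_unitCube (n : Fin d → ℤ) :
    ∫ x in unitCube d, Complex.exp (2 * Real.pi * Complex.I * (((fun i => (n i : ℝ)) ⬝ᵥ x : ℝ) : ℂ))
      = if n = 0 then 1 else 0 := by
  have h := orthonormal_iff_ite.mp (UnitAddTorus.orthonormal_mFourier (d := Fin d)) 0 n
  rw [ContinuousMap.inner_toLp] at h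
  simp only [UnitAddTorus.mFourier_zero, ContinuousMap.one_apply, map_one, mul_one] at h
  rw [UnitAddTorus.integral_preimage _ 0] at h
  simp only [mFourier_coe] at h
  rw [setIntegral_congr_set unitCube_ae_eq] at h
  rw [h]
  simp [eq_comm]

theorem hasSum_unitCube {h : (Fin d → ℝ) → ℂ} (hh : MemLp h 2 (volume.restrict (unitCube d))) :
    HasSum (fun n : Fin d → ℤ => ‖∫ x in unitCube d,
      (starRingEnd ℂ) (Complex.exp (2 * Real.pi * Complex.I *
        (((fun i => (n i : ℝ)) ⬝ᵥ x : ℝ) : ℂ))) * h x‖ ^ 2)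
      (∫ x in unitCube d, ‖h x‖ ^ 2) := by
  have hm : MeasurableSet {x : Fin d → ℝ |
      ∀ i, x i ∈ Set.Ioc ((0 : Fin d → ℝ) i) ((0 : Fin d → ℝ) i + 1)} :=
    MeasurableSet.univ_pi' fun i => measurableSet_Ioc
  rw [Measure.restrict_congr_set unitCube_ae_eq.symm] at hh ⊢
  have hmp := (measurePreserving_subtype_coe hm).comp
    (UnitAddTorus.measurePreserving_equivPiIoc (d := Fin d) 0)
  -- A measure preserving section of the quotient map; `h ∘ σ` carries `h` to the torus, where
  -- Parseval is known.
  set σ : UnitAddTorus (Fin d) → (Fin d → ℝ) :=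
    Subtype.val ∘ UnitAddTorus.measurableEquivPiIoc 0
  have hσ (x : Fin d → ℝ)
      (hx : ∀ i, x i ∈ Set.Ioc ((0 : Fin d → ℝ) i) ((0 : Fin d → ℝ) i + 1)) :
      σ (fun i => (x i : UnitAddCircle)) = x := by
    have := (UnitAddTorus.measurableEquivPiIoc (0 : Fin d → ℝ)).apply_symm_apply ⟨x, hx⟩
    exact congrArg Subtype.val this
  have hf : MemLp (h ∘ σ) 2 volume := hh.comp_measurePreserving hmp
  have hsum := UnitAddTorus.hasSum_sq_mFourierCoeff (hf.toLp _)
  have h1 (n : Fin d → ℤ) : UnitAddTorus.mFourierCoeff (hf.toLp _) n = ∫ x in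
      {x : Fin d → ℝ | ∀ i, x i ∈ Set.Ioc ((0 : Fin d → ℝ) i) ((0 : Fin d → ℝ) i + 1)},
      (starRingEnd ℂ) (Complex.exp (2 * Real.pi * Complex.I *
        (((fun i => (n i : ℝ)) ⬝ᵥ x : ℝ) : ℂ))) * h x := by
    have h2 : UnitAddTorus.mFourierCoeff (hf.toLp _) n = UnitAddTorus.mFourierCoeff (h ∘ σ) n := by
      refine integral_congr_ae ?_
      filter_upwards [hf.coeFn_toLp] with t ht
      rw [ht]
    rw [h2, UnitAddTorus.mFourierCoeff_eq_integral _ _ 0]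
    refine setIntegral_congr_fun hm fun x hx => ?_
    simp only [UnitAddTorus.mFourier_neg, mFourier_coe, Function.comp_apply, hσ x hx, smul_eq_mul]
  have h3 : ∫ t, ‖hf.toLp _ t‖ ^ 2 = ∫ x in
      {x : Fin d → ℝ | ∀ i, x i ∈ Set.Ioc ((0 : Fin d → ℝ) i) ((0 : Fin d → ℝ) i + 1)},
      ‖h x‖ ^ 2 := by
    have h2 : ∫ t, ‖hf.toLp _ t‖ ^ 2 = ∫ t, ‖(h ∘ σ) t‖ ^ 2 := by
      refine integral_congr_ae ?_
      filter_upwards [hf.coeFn_toLp] with t ht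
      rw [ht]
    rw [h2, UnitAddTorus.integral_preimage _ 0]
    refine setIntegral_congr_fun hm fun x hx => ?_
    simp only [Function.comp_apply, hσ x hx]
  simpa only [h1, h3] using hsum

variable (M : Matrix (Fin d) (Fin d) ℝ)

/-- The measurable equivalence `t ↦ M t` from `ℝ^d` to Euclidean space. -/
noncomputable def cellEquiv (hM : M.det ≠ 0) : (Fin d → ℝ) ≃ᵐ EuclideanSpace ℝ (Fin d) :=
  ((Matrix.toLinearEquiv' M (M.invertibleOfIsUnitDet hM.isUnit)).toContinuousLinearEquiv.trans
    (EuclideanSpace.equiv (Fin d) ℝ).symm).toHomeomorph.toMeasurableEquiv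

theorem cellEquiv_apply (hM : M.det ≠ 0) (t : Fin d → ℝ) :
    cellEquiv M hM t = WithLp.toLp 2 (M *ᵥ t) := rfl

theorem cellEquiv_preimage_fundCell (hM : M.det ≠ 0) :
    cellEquiv M hM ⁻¹' fundCell M = unitCube d := by
  ext t
  constructor
  · rintro ⟨t', ht', h⟩
    have : t = t' := (cellEquiv M hM).injective h
    subst this
    exact fun i _ => ht' i
  · exact fun h => ⟨t, fun i => h i trivial, rfl⟩

theorem map_cellEquiv_restrict (hM : M.det ≠ 0) :
    Measure.map (cellEquiv M hM) (volume.restrict (unitCube d)) =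
      ENNReal.ofReal |M.det⁻¹| • volume.restrict (fundCell M) := by
  have h1 : Measure.map (cellEquiv M hM) volume = ENNReal.ofReal |M.det⁻¹| • volume := by
    have h2 : (cellEquiv M hM : (Fin d → ℝ) → EuclideanSpace ℝ (Fin d)) =
        WithLp.toLp 2 ∘ Matrix.toLin' M := rfl
    rw [h2, ← Measure.map_map (PiLp.volume_preserving_toLp (Fin d)).measurable
      (by fun_prop), Real.map_matrix_volume_pi_eq_smul_volume_pi hM, Measure.map_smul,
      (PiLp.volume_preserving_toLp (Fin d)).map_eq]
  rw [← cellEquiv_preimage_fundCell M hM, ← (cellEquiv M hM).restrict_map, h1,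
    Measure.restrict_smul]

theorem integral_unitCube_comp_cellEquiv (hM : M.det ≠ 0) {E : Type*} [NormedAddCommGroup E]
    [NormedSpace ℝ E] (h : EuclideanSpace ℝ (Fin d) → E) :
    ∫ t in unitCube d, h (cellEquiv M hM t) = |M.det|⁻¹ • ∫ x in fundCell M, h x := by
  rw [← (cellEquiv M hM).measurableEmbedding.integral_map, map_cellEquiv_restrict,
    integral_smul_measure, ENNReal.toReal_ofReal (abs_nonneg _), abs_inv]

/-- The element `M^{-T} n` of the dual lattice. -/
noncomputable def dualPoint (n : Fin d → ℤ) : EuclideanSpace ℝ (Fin d) :=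
  WithLp.toLp 2 ((M⁻¹)ᵀ *ᵥ fun i => (n i : ℝ))

/-- In the coordinates `x = M t`, the exponentials of the dual lattice become the standard
characters of the cube. -/
theorem inner_dualPoint_cellEquiv (hM : M.det ≠ 0) (n : Fin d → ℤ) (t : Fin d → ℝ) :
    inner ℝ (dualPoint M n) (cellEquiv M hM t) = (fun i => (n i : ℝ)) ⬝ᵥ t := by
  rw [dualPoint, cellEquiv_apply, EuclideanSpace.inner_toLp_toLp, star_trivial,
    Matrix.mulVec_transpose, dotProduct_comm, ← Matrix.dotProduct_mulVec, Matrix.mulVec_mulVec,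
    Matrix.nonsing_inv_mul _ hM.isUnit, Matrix.one_mulVec]

theorem expFun_dualPoint_cellEquiv (hM : M.det ≠ 0) (n : Fin d → ℤ) (t : Fin d → ℝ) :
    expFun (dualPoint M n) (cellEquiv M hM t) =
      Complex.exp (2 * Real.pi * Complex.I * (((fun i => (n i : ℝ)) ⬝ᵥ t : ℝ) : ℂ)) := by
  rw [expFun, inner_dualPoint_cellEquiv]

/-- Parseval's identity for the exponentials `e_u`, `u ∈ Λ*`, on the fundamental cell. -/
theorem hasSum_fundCell (hM : M.det ≠ 0) {h : EuclideanSpace ℝ (Fin d) → ℂ}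
    (hh : MemLp h 2 (volume.restrict (fundCell M))) :
    HasSum (fun n : Fin d → ℤ => ‖∫ x in fundCell M,
      (starRingEnd ℂ) (expFun (dualPoint M n) x) * h x‖ ^ 2)
      (|M.det| * ∫ x in fundCell M, ‖h x‖ ^ 2) := by
  have hdet : |M.det| ≠ 0 := abs_ne_zero.mpr hM
  have h1 : MemLp (h ∘ cellEquiv M hM) 2 (volume.restrict (unitCube d)) := by
    refine MemLp.comp_of_map ?_ (cellEquiv M hM).measurable.aemeasurable
    rw [map_cellEquiv_restrict]
    exact hh.smul_measure ENNReal.ofReal_ne_top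
  have h2 := hasSum_unitCube h1
  simp only [← expFun_dualPoint_cellEquiv M hM, Function.comp_apply] at h2
  have h3 (n : Fin d → ℤ) := integral_unitCube_comp_cellEquiv M hM
    fun x => (starRingEnd ℂ) (expFun (dualPoint M n) x) * h x
  have h4 := integral_unitCube_comp_cellEquiv M hM fun x => ‖h x‖ ^ 2
  simp only [h3, h4] at h2
  -- Each squared coefficient carries `|det M|⁻²` from the change of variables, the squared norm
  -- only `|det M|⁻¹`.
  convert! h2.mul_left (|M.det| ^ 2) using 1
  · funext n
    rw [norm_smul, mul_pow, norm_inv, Real.norm_eq_abs, abs_abs]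
    field_simp
  · rw [smul_eq_mul]
    field_simp

theorem integral_expFun_fundCell (hM : M.det ≠ 0) (n : Fin d → ℤ) :
    ∫ x in fundCell M, expFun (dualPoint M n) x = if n = 0 then ((|M.det| : ℝ) : ℂ) else 0 := by
  have hdet : ((|M.det| : ℝ) : ℂ) ≠ 0 := by simpa using hM
  have h := integral_unitCube_comp_cellEquiv M hM (expFun (dualPoint M n))
  simp only [expFun_dualPoint_cellEquiv, integral_mFourier_unitCube] at h
  have h' : ((|M.det|⁻¹ : ℝ) : ℂ) * ∫ x in fundCell M, expFun (dualPoint M n) x =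
      if n = 0 then 1 else 0 := by rw [h, Complex.real_smul]
  rw [Complex.ofReal_inv, inv_mul_eq_iff_eq_mul₀ hdet] at h'
  rw [h']
  split_ifs <;> simp

theorem volume_fundCell (hM : M.det ≠ 0) :
    volume (fundCell M) = ENNReal.ofReal |M.det| := by
  have h := congrArg (fun m => m Set.univ) (map_cellEquiv_restrict M hM)
  simp only [(cellEquiv M hM).map_apply, Set.preimage_univ, Measure.restrict_apply_univ,
    Measure.smul_apply, smul_eq_mul] at h
  have h1 : volume (unitCube d) = 1 := by
    rw [unitCube, Real.volume_pi_Ico]; simp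
  have h2 : ENNReal.ofReal |M.det| * ENNReal.ofReal |M.det⁻¹| = 1 := by
    rw [← ENNReal.ofReal_mul (abs_nonneg _), ← abs_mul, mul_inv_cancel₀ hM]; simp
  rw [← one_mul (volume (fundCell M)), ← h2, mul_assoc, ← h, h1, mul_one]

end FourierCell

/-! ### The maps `ω` between fundamental domains. -/

section Omega

variable {d : ℕ} {M : Matrix (Fin d) (Fin d) ℝ} {D D' : Set (EuclideanSpace ℝ (Fin d))}
  {x : EuclideanSpace ℝ (Fin d)}

theorem latticePoint_mem (M : Matrix (Fin d) (Fin d) ℝ) (D : Set (EuclideanSpace ℝ (Fin d)))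
    (x : EuclideanSpace ℝ (Fin d)) : latticePoint M D x ∈ lattice M := by
  rw [latticePoint]
  split_ifs with h
  · exact h.choose_spec.1
  · exact zero_mem _

theorem latticePoint_eq (hx : ∃! l : lattice M, x + (l : EuclideanSpace ℝ (Fin d)) ∈ D)
    {l : EuclideanSpace ℝ (Fin d)} (hl : l ∈ lattice M) (h : x + l ∈ D) :
    latticePoint M D x = l := by
  have h' : ∃ l ∈ lattice M, x + l ∈ D := ⟨l, hl, h⟩
  rw [latticePoint, dif_pos h']
  exact congrArg Subtype.val
    (hx.unique (y₁ := ⟨_, h'.choose_spec.1⟩) (y₂ := ⟨l, hl⟩) h'.choose_spec.2 h)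

theorem omega_mem (hx : ∃! l : lattice M, x + (l : EuclideanSpace ℝ (Fin d)) ∈ D) :
    omega M D x ∈ D := by
  obtain ⟨l, hl⟩ := hx.exists
  rw [omega, latticePoint_eq hx l.2 hl]
  exact hl

theorem omega_eq_self (hx : ∃! l : lattice M, x + (l : EuclideanSpace ℝ (Fin d)) ∈ D)
    (h : x ∈ D) : omega M D x = x := by
  rw [omega, latticePoint_eq hx (zero_mem _) (by rwa [add_zero]), add_zero]

theorem existsUnique_add_iff (l : lattice M) :
    (∃! m : lattice M, l + x + (m : EuclideanSpace ℝ (Fin d)) ∈ D) ↔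
      ∃! m : lattice M, x + (m : EuclideanSpace ℝ (Fin d)) ∈ D := by
  rw [(Equiv.addLeft (-l)).bijective.existsUnique_iff]
  have h (m : lattice M) : (l : EuclideanSpace ℝ (Fin d)) + x +
      (Equiv.addLeft (-l) m : lattice M) = x + (m : EuclideanSpace ℝ (Fin d)) := by
    rw [Equiv.coe_addLeft, AddSubgroup.coe_add, AddSubgroup.coe_neg]; abel
  simp only [h]

/-- `ω(x)` is the representative in `D` of the coset `x + Λ`. -/
theorem omega_add (hx : ∃! l : lattice M, x + (l : EuclideanSpace ℝ (Fin d)) ∈ D)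
    (l : lattice M) : omega M D (l + x) = omega M D x := by
  have h1 : (l : EuclideanSpace ℝ (Fin d)) + x + (latticePoint M D x - l) = omega M D x := by
    rw [omega]; abel
  have h2 := latticePoint_eq ((existsUnique_add_iff l).mpr hx)
    (sub_mem (latticePoint_mem M D x) l.2) (by rw [h1]; exact omega_mem hx)
  rw [omega, h2, h1]

theorem ae_existsUnique_mem (hD : IsAddFundamentalDomain (lattice M) D volume) :
    ∀ᵐ x ∂(volume : Measure (EuclideanSpace ℝ (Fin d))),
      ∃! l : lattice M, x + (l : EuclideanSpace ℝ (Fin d)) ∈ D := by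
  have h : ∀ᵐ x ∂(volume : Measure (EuclideanSpace ℝ (Fin d))), ∀ g g' : lattice M, g ≠ g' →
      ¬ (x ∈ (fun y : EuclideanSpace ℝ (Fin d) => g +ᵥ y) '' D ∧
        x ∈ (fun y : EuclideanSpace ℝ (Fin d) => g' +ᵥ y) '' D) := by
    simp only [ae_all_iff]
    intro g g' hgg'
    exact measure_eq_zero_iff_ae_notMem.mp (hD.aedisjoint hgg')
  filter_upwards [h, hD.ae_covers] with x hx hcov
  obtain ⟨l, hl⟩ := hcov
  refine ⟨l, by beta_reduce; rw [add_comm]; exact hl, fun m hm => ?_⟩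
  by_contra hml
  refine hx (-m) (-l) (fun h => hml (neg_injective h)) ⟨⟨_, hm, ?_⟩, ⟨_, hl, ?_⟩⟩
  · change ((-m : lattice M) : EuclideanSpace ℝ (Fin d)) + _ = _
    rw [AddSubgroup.coe_neg]; abel
  · exact neg_vadd_vadd l x

/-- The countably many translates `D - l` cover almost everything, and `λ` is a.e. constant on each.
-/
theorem aemeasurable_latticePoint (hD : IsAddFundamentalDomain (lattice M) D volume) :
    AEMeasurable (latticePoint M D) volume := by
  have hcov : (⋃ l : lattice M, {x | x + (l : EuclideanSpace ℝ (Fin d)) ∈ D}) =ᵐ[volume]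
      (Set.univ : Set (EuclideanSpace ℝ (Fin d))) := by
    rw [Filter.eventuallyEq_univ]
    filter_upwards [ae_existsUnique_mem hD] with x hx
    exact Set.mem_iUnion.mpr hx.exists
  rw [← Measure.restrict_univ (μ := volume), ← Measure.restrict_congr_set hcov,
    aemeasurable_iUnion_iff]
  intro l
  have hm : NullMeasurableSet {x | x + (l : EuclideanSpace ℝ (Fin d)) ∈ D} volume :=
    hD.nullMeasurableSet.preimage (measurePreserving_add_right volume _).quasiMeasurePreserving
  refine (aemeasurable_const (b := (l : EuclideanSpace ℝ (Fin d)))).congr ?_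
  filter_upwards [ae_restrict_mem₀ hm, ae_restrict_of_ae (ae_existsUnique_mem hD)] with x hx hx'
  exact (latticePoint_eq hx' l.2 hx).symm

theorem aemeasurable_omega (hD : IsAddFundamentalDomain (lattice M) D volume) :
    AEMeasurable (omega M D) volume :=
  aemeasurable_id.add (aemeasurable_latticePoint hD)

/-- The map `ω` onto a fundamental domain is measure preserving on any fundamental domain. -/
theorem map_omega (hD' : IsAddFundamentalDomain (lattice M) D' volume)
    (hD : IsAddFundamentalDomain (lattice M) D volume) :
    Measure.map (omega M D) (volume.restrict D') = volume.restrict D := by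
  refine Measure.ext fun A hA => ?_
  have hm := aemeasurable_omega hD
  have hgood := ae_existsUnique_mem hD
  have hAm : NullMeasurableSet (omega M D ⁻¹' A) volume := hm.nullMeasurable hA
  -- Cutting down to `G` makes `ω⁻¹(A)` exactly `Λ`-invariant, so it has equal measure in `D'` and
  -- in `D`; on `D` the map `ω` is a.e. the identity.
  set G : Set (EuclideanSpace ℝ (Fin d)) :=
    {x | ∃! l : lattice M, x + (l : EuclideanSpace ℝ (Fin d)) ∈ D}
  have hG : G =ᵐ[volume] (Set.univ : Set (EuclideanSpace ℝ (Fin d))) := by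
    rw [Filter.eventuallyEq_univ]; exact hgood
  have hGA : (G ∩ omega M D ⁻¹' A : Set _) =ᵐ[volume] omega M D ⁻¹' A := by
    simpa using hG.inter (ae_eq_refl (omega M D ⁻¹' A))
  have hGm : NullMeasurableSet (G ∩ omega M D ⁻¹' A) volume := hAm.congr hGA.symm
  have key := hD'.setLIntegral_eq hD ((G ∩ omega M D ⁻¹' A).indicator 1) (by
    intro g x
    have h1 : g +ᵥ x ∈ G ∩ omega M D ⁻¹' A ↔ x ∈ G ∩ omega M D ⁻¹' A := by
      have h2 : g +ᵥ x ∈ G ↔ x ∈ G := existsUnique_add_iff g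
      rw [Set.mem_inter_iff, Set.mem_inter_iff, h2, and_congr_right_iff]
      intro hx
      rw [Set.mem_preimage, Set.mem_preimage, ← omega_add hx g]
      rfl
    by_cases hx : x ∈ G ∩ omega M D ⁻¹' A
    · rw [Set.indicator_of_mem hx, Set.indicator_of_mem (h1.mpr hx)]; rfl
    · rw [Set.indicator_of_notMem hx, Set.indicator_of_notMem (mt h1.mp hx)])
  rw [lintegral_indicator_one₀ (hGm.mono Measure.restrict_le_self),
    lintegral_indicator_one₀ (hGm.mono Measure.restrict_le_self)] at key
  rw [Measure.map_apply_of_aemeasurable hm.restrict hA,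
    ← measure_congr (ae_restrict_of_ae hGA), key]
  refine measure_congr ?_
  filter_upwards [ae_restrict_mem₀ hD.nullMeasurableSet, ae_restrict_of_ae hgood] with x hx hx'
  refine propext ⟨fun h => ?_, fun h => ⟨hx', ?_⟩⟩
  · rw [← omega_eq_self hx' hx]; exact h.2
  · change omega M D x ∈ A
    rwa [omega_eq_self hx' hx]

theorem ae_omega_omega (D' : Set (EuclideanSpace ℝ (Fin d)))
    (hD : IsAddFundamentalDomain (lattice M) D volume) :
    ∀ᵐ y ∂volume.restrict D, omega M D (omega M D' y) = y := by
  filter_upwards [ae_restrict_mem₀ hD.nullMeasurableSet,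
    ae_restrict_of_ae (ae_existsUnique_mem hD)] with y hy hy'
  have h := omega_add hy' ⟨latticePoint M D' y, latticePoint_mem M D' y⟩
  rw [omega_eq_self hy' hy, add_comm] at h
  exact h

/-- Almost everywhere on `D`, `f` is `(f ∘ ω_D) ∘ ω_{D'}`. This yields measurability of the dual
functions, whose formula contains an inverse obtained by choice. -/
theorem aestronglyMeasurable_of_comp_omega (hD' : IsAddFundamentalDomain (lattice M) D' volume)
    (hD : IsAddFundamentalDomain (lattice M) D volume) {E : Type*} [TopologicalSpace E]
    {f : EuclideanSpace ℝ (Fin d) → E}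
    (hf : AEStronglyMeasurable (f ∘ omega M D) (volume.restrict D')) :
    AEStronglyMeasurable f (volume.restrict D) := by
  rw [← map_omega hD hD'] at hf
  refine (hf.comp_aemeasurable (aemeasurable_omega hD').restrict).congr ?_
  filter_upwards [ae_omega_omega D' hD] with y hy
  simp only [Function.comp_apply, hy]

theorem existsUnique_add_mem_fundCell (hM : M.det ≠ 0) (x : EuclideanSpace ℝ (Fin d)) :
    ∃! l : lattice M, x + (l : EuclideanSpace ℝ (Fin d)) ∈ fundCell M := by
  obtain ⟨t, rfl⟩ := (cellEquiv M hM).surjective x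
  have hadd (z : Fin d → ℤ) : cellEquiv M hM t + WithLp.toLp 2 (M *ᵥ fun i => (z i : ℝ)) ∈
      fundCell M ↔ ∀ i, t i + z i ∈ Set.Ico (0 : ℝ) 1 := by
    have h1 : cellEquiv M hM t + WithLp.toLp 2 (M *ᵥ fun i => (z i : ℝ)) =
        cellEquiv M hM (t + fun i => (z i : ℝ)) := by
      rw [cellEquiv_apply, cellEquiv_apply, Matrix.mulVec_add, WithLp.toLp_add]
    rw [h1, ← Set.mem_preimage, cellEquiv_preimage_fundCell]
    simp [unitCube, Set.mem_pi]
  refine ⟨⟨_, fun i => -⌊t i⌋, rfl⟩, ?_, ?_⟩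
  · refine (hadd _).mpr fun i => ?_
    have h0 := Int.floor_le (t i)
    have h1 := Int.lt_floor_add_one (t i)
    push_cast
    constructor <;> linarith
  · rintro ⟨_, z, rfl⟩ hz
    refine Subtype.ext ?_
    have hz' := (hadd z).mp hz
    have : z = fun i => -⌊t i⌋ := by
      funext i
      have h := hz' i
      have h2 : ⌊t i⌋ = -z i := by
        rw [Int.floor_eq_iff]
        push_cast
        constructor <;> linarith [h.1, h.2]
      omega
    rw [this]

theorem measurableSet_fundCell (hM : M.det ≠ 0) : MeasurableSet (fundCell M) := by
  rw [← (cellEquiv M hM).measurableSet_preimage, cellEquiv_preimage_fundCell]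
  exact measurableSet_unitCube

theorem isAddFundamentalDomain_fundCell (hM : M.det ≠ 0) :
    IsAddFundamentalDomain (lattice M) (fundCell M) volume :=
  .mk' (measurableSet_fundCell hM).nullMeasurableSet fun x => by
    have h := existsUnique_add_mem_fundCell hM x
    simp only [add_comm x] at h
    exact h

/-- Two cell points with the same image differ by a lattice vector, hence coincide. No condition on
`D` enters, since the default value `0` of `latticePoint` also lies in `Λ`. -/
theorem omegaInv_omega (hM : M.det ≠ 0) (D : Set (EuclideanSpace ℝ (Fin d)))
    (hx : x ∈ fundCell M) : omegaInv M D (omega M D x) = x := by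
  refine Set.InjOn.leftInvOn_invFunOn (fun y hy z hz hyz => ?_) hx
  have h1 : z + (latticePoint M D z - latticePoint M D y) = y := by
    rw [← add_sub_assoc, sub_eq_iff_eq_add]; exact hyz.symm
  have h2 := (existsUnique_add_mem_fundCell hM z).unique
    (y₁ := ⟨_, sub_mem (latticePoint_mem M D z) (latticePoint_mem M D y)⟩) (y₂ := 0)
    (by rwa [h1]) (by simpa using hz)
  rw [← h1, show latticePoint M D z - latticePoint M D y = 0 from congrArg Subtype.val h2, add_zero]

theorem IsTilePartition.restrict_eq_sum {k : ℕ} {Ω : Set (EuclideanSpace ℝ (Fin d))}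
    {P : Fin k → Set (EuclideanSpace ℝ (Fin d))} (hP : IsTilePartition M Ω P) :
    (volume.restrict Ω : Measure (EuclideanSpace ℝ (Fin d))) =
      Measure.sum fun r => volume.restrict (P r) := by
  rw [← Measure.restrict_iUnion_ae (fun r r' h => (hP.pairwise_disjoint h).aedisjoint)
    fun r => (hP.isAddFundamentalDomain r).nullMeasurableSet]
  refine Measure.restrict_congr_set ?_
  refine Filter.EventuallyLE.antisymm (ae_le_set.mpr hP.volume_diff) ?_
  exact (Set.iUnion_subset hP.subset).eventuallyLE

end Omega

/-! ### Families of the form `ε_n m_s` after transfer to `k` copies of one space. -/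

section Modulation

variable {X Y : Type*} [MeasurableSpace X] [MeasurableSpace Y] {μ : Measure X} {ν : Measure Y}
  {k : ℕ} {ω : Fin k → X → Y}

theorem map_le_of_eq_sum (hν : ν = Measure.sum fun r => μ.map (ω r)) (r : Fin k) :
    μ.map (ω r) ≤ ν := hν ▸ Measure.le_sum _ r

theorem memLp_comp_of_eq_sum_map (hω : ∀ r, AEMeasurable (ω r) μ)
    (hν : ν = Measure.sum fun r => μ.map (ω r)) {f : Y → ℂ} (hf : MemLp f 2 ν) (r : Fin k) :
    MemLp (f ∘ ω r) 2 μ :=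
  (hf.mono_measure (map_le_of_eq_sum hν r)).comp_of_map (hω r)

theorem memLp_of_comp_of_eq_sum_map (hω : ∀ r, AEMeasurable (ω r) μ)
    (hν : ν = Measure.sum fun r => μ.map (ω r)) {f : Y → ℂ}
    (hfm : ∀ r, AEStronglyMeasurable f (μ.map (ω r))) (hf : ∀ r, MemLp (f ∘ ω r) 2 μ) :
    MemLp f 2 ν := by
  have hfν : AEStronglyMeasurable f ν := by
    rw [hν]; exact aestronglyMeasurable_sum_measure_iff.mpr hfm
  rw [memLp_two_iff_integrable_sq_norm hfν, hν, integrable_sum_measure_iff]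
  refine ⟨fun r => ?_, (hasSum_fintype _).summable⟩
  rw [← memLp_two_iff_integrable_sq_norm (hfm r)]
  exact (memLp_map_measure_iff (hfm r) (hω r)).mpr (hf r)

theorem integral_eq_sum_integral_comp {E : Type*} [NormedAddCommGroup E] [NormedSpace ℝ E]
    (hω : ∀ r, AEMeasurable (ω r) μ) (hν : ν = Measure.sum fun r => μ.map (ω r)) {f : Y → E}
    (hf : Integrable f ν) : ∫ y, f y ∂ν = ∑ r, ∫ x, f (ω r x) ∂μ := by
  subst hν
  rw [(hasSum_integral_measure hf).unique (hasSum_fintype _)]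
  refine Finset.sum_congr rfl fun r _ => ?_
  rw [integral_map (hω r) (hf.1.mono_measure (Measure.le_sum _ r))]

theorem inner_eq_sum_integral_comp (hω : ∀ r, AEMeasurable (ω r) μ)
    (hν : ν = Measure.sum fun r => μ.map (ω r)) (f g : Lp ℂ 2 ν) :
    inner ℂ f g = ∑ r, ∫ x, (starRingEnd ℂ) (f (ω r x)) * g (ω r x) ∂μ := by
  rw [L2.inner_def, integral_eq_sum_integral_comp hω hν (L2.integrable_inner f g)]
  simp only [RCLike.inner_apply, mul_comm]

theorem norm_sq_eq_sum_integral_comp (hω : ∀ r, AEMeasurable (ω r) μ)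
    (hν : ν = Measure.sum fun r => μ.map (ω r)) (f : Lp ℂ 2 ν) :
    ‖f‖ ^ 2 = ∑ r, ∫ x, ‖f (ω r x)‖ ^ 2 ∂μ := by
  have h := inner_eq_sum_integral_comp hω hν f f
  simp only [inner_self_eq_norm_sq_to_K, RCLike.conj_mul, Complex.coe_algebraMap,
    ← Complex.ofReal_pow, integral_complex_ofReal, ← Complex.ofReal_sum] at h
  exact Complex.ofReal_injective h

/-- The function `∑_r conj(m_r) f ∘ ω_r`. -/
noncomputable def modulatedSum (ω : Fin k → X → Y) (m : Fin k → X → ℂ) (f : Y → ℂ) (x : X) : ℂ :=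
  ∑ r, (starRingEnd ℂ) (m r x) * f (ω r x)

theorem memLp_conj_mul_comp (hω : ∀ r, AEMeasurable (ω r) μ)
    (hν : ν = Measure.sum fun r => μ.map (ω r)) {m : X → ℂ} {C : ℝ}
    (hm : AEStronglyMeasurable m μ) (hmC : ∀ᵐ x ∂μ, ‖m x‖ ≤ C) (f : Lp ℂ 2 ν) (r : Fin k) :
    MemLp (fun x => (starRingEnd ℂ) (m x) * f (ω r x)) 2 μ := by
  have hf := memLp_comp_of_eq_sum_map hω hν (Lp.memLp f) r
  refine hf.of_le_mul (c := C)
    ((Complex.continuous_conj.comp_aestronglyMeasurable hm).mul hf.1) ?_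
  filter_upwards [hmC] with x hx
  rw [norm_mul, RCLike.norm_conj]
  exact mul_le_mul_of_nonneg_right hx (norm_nonneg _)

theorem memLp_modulatedSum (hω : ∀ r, AEMeasurable (ω r) μ)
    (hν : ν = Measure.sum fun r => μ.map (ω r)) {m : Fin k → X → ℂ} {C : ℝ}
    (hm : ∀ r, AEStronglyMeasurable (m r) μ) (hmC : ∀ r, ∀ᵐ x ∂μ, ‖m r x‖ ≤ C) (f : Lp ℂ 2 ν) :
    MemLp (modulatedSum ω m f) 2 μ :=
  memLp_finsetSum _ fun r _ => memLp_conj_mul_comp hω hν (hm r) (hmC r) f r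

theorem integral_norm_modulatedSum_sq_le (hω : ∀ r, AEMeasurable (ω r) μ)
    (hν : ν = Measure.sum fun r => μ.map (ω r)) {m : Fin k → X → ℂ} {C : ℝ}
    (hm : ∀ r, AEStronglyMeasurable (m r) μ) (hmC : ∀ r, ∀ᵐ x ∂μ, ‖m r x‖ ≤ C) (f : Lp ℂ 2 ν) :
    ∫ x, ‖modulatedSum ω m f x‖ ^ 2 ∂μ ≤ k * C ^ 2 * ‖f‖ ^ 2 := by
  have hint (r : Fin k) : Integrable (fun x => ‖f (ω r x)‖ ^ 2) μ :=
    (memLp_comp_of_eq_sum_map hω hν (Lp.memLp f) r).integrable_norm_pow two_ne_zero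
  rw [norm_sq_eq_sum_integral_comp hω hν, ← integral_finsetSum _ fun r _ => hint r,
    ← integral_const_mul]
  refine integral_mono_ae
    ((memLp_modulatedSum hω hν hm hmC f).integrable_norm_pow two_ne_zero)
    ((integrable_finsetSum _ fun r _ => hint r).const_mul _) ?_
  filter_upwards [ae_all_iff.mpr hmC] with x hx
  -- Cauchy–Schwarz over the `k` sheets gives the factor `k`.
  calc ‖modulatedSum ω m f x‖ ^ 2
      ≤ (∑ r, ‖(starRingEnd ℂ) (m r x) * f (ω r x)‖) ^ 2 := by gcongr; exact norm_sum_le _ _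
    _ ≤ (Finset.univ : Finset (Fin k)).card * ∑ r, ‖(starRingEnd ℂ) (m r x) * f (ω r x)‖ ^ 2 :=
        sq_sum_le_card_mul_sum_sq
    _ ≤ k * ∑ r, (C * ‖f (ω r x)‖) ^ 2 := by
        rw [Finset.card_univ, Fintype.card_fin]
        gcongr with r _
        rw [norm_mul, RCLike.norm_conj]
        gcongr
        exact hx r
    _ = _ := by simp only [mul_pow, ← Finset.mul_sum, mul_assoc]

variable {N : Type*} {ε : N → X → ℂ} {c : ℝ} {φ : N × Fin k → Lp ℂ 2 ν}
  {m : Fin k → Fin k → X → ℂ} {C : ℝ}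

/-- For fixed `s` the inner products are the `ε`-coefficients of a single function on `X`; this lets
Parseval on `X` control the whole family. -/
theorem inner_eq_integral_modulatedSum (hω : ∀ r, AEMeasurable (ω r) μ)
    (hν : ν = Measure.sum fun r => μ.map (ω r))
    (hφ : ∀ p r, ∀ᵐ x ∂μ, φ p (ω r x) = ε p.1 x * m p.2 r x) (f : Lp ℂ 2 ν) (p : N × Fin k) :
    inner ℂ (φ p) f =
      ∫ x, (starRingEnd ℂ) (ε p.1 x) * modulatedSum ω (m p.2) f x ∂μ := by
  rw [inner_eq_sum_integral_comp hω hν, ← integral_finsetSum]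
  · refine integral_congr_ae ?_
    filter_upwards [ae_all_iff.mpr (hφ p)] with x hx
    simp only [hx, modulatedSum, Finset.mul_sum, map_mul, mul_assoc]
  · intro r _
    exact ((memLp_comp_of_eq_sum_map hω hν (Lp.memLp (φ p)) r).star).integrable_mul
      (memLp_comp_of_eq_sum_map hω hν (Lp.memLp f) r)

theorem isBesselWith_of_modulated (hω : ∀ r, AEMeasurable (ω r) μ)
    (hν : ν = Measure.sum fun r => μ.map (ω r))
    (hε : ∀ h : X → ℂ, MemLp h 2 μ →
      HasSum (fun n => ‖∫ x, (starRingEnd ℂ) (ε n x) * h x ∂μ‖ ^ 2) (c * ∫ x, ‖h x‖ ^ 2 ∂μ))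
    (hc : 0 ≤ c) (hφ : ∀ p r, ∀ᵐ x ∂μ, φ p (ω r x) = ε p.1 x * m p.2 r x)
    (hm : ∀ s r, AEStronglyMeasurable (m s r) μ) (hmC : ∀ s r, ∀ᵐ x ∂μ, ‖m s r x‖ ≤ C) :
    IsBesselWith φ (k * (c * (k * C ^ 2))) := by
  classical
  intro f S
  calc ∑ p ∈ S, ‖inner ℂ (φ p) f‖ ^ 2
      -- Enlarging `S` to a product allows Parseval for each `s` separately; the outer factor `k` in
      -- the bound counts the values of `s`.
      ≤ ∑ p ∈ S.image Prod.fst ×ˢ Finset.univ, ‖inner ℂ (φ p) f‖ ^ 2 := by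
        refine Finset.sum_le_sum_of_subset_of_nonneg (fun p hp => ?_) fun _ _ _ => by positivity
        exact Finset.mem_product.mpr ⟨Finset.mem_image_of_mem _ hp, Finset.mem_univ _⟩
    _ = ∑ s, ∑ n ∈ S.image Prod.fst,
          ‖∫ x, (starRingEnd ℂ) (ε n x) * modulatedSum ω (m s) f x ∂μ‖ ^ 2 := by
        rw [Finset.sum_product_right]
        simp only [inner_eq_integral_modulatedSum hω hν hφ]
    _ ≤ ∑ s : Fin k, c * (k * C ^ 2 * ‖f‖ ^ 2) := by
        refine Finset.sum_le_sum fun s _ => ?_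
        refine (sum_le_hasSum _ (fun _ _ => by positivity)
          (hε _ (memLp_modulatedSum hω hν (hm s) (hmC s) f))).trans ?_
        gcongr
        exact integral_norm_modulatedSum_sq_le hω hν (hm s) (hmC s) f
    _ = _ := by simp; ring

theorem inner_modulated (hω : ∀ r, AEMeasurable (ω r) μ)
    (hν : ν = Measure.sum fun r => μ.map (ω r)) {ψ : N × Fin k → Lp ℂ 2 ν}
    {m' : Fin k → Fin k → X → ℂ} {κ : ℂ}
    (hφ : ∀ p r, ∀ᵐ x ∂μ, φ p (ω r x) = ε p.1 x * m p.2 r x)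
    (hψ : ∀ p r, ∀ᵐ x ∂μ, ψ p (ω r x) = ε p.1 x * m' p.2 r x)
    (hmm' : ∀ s s', ∀ᵐ x ∂μ,
      ∑ r, (starRingEnd ℂ) (m s r x) * m' s' r x = if s = s' then κ else 0) (p q : N × Fin k) :
    inner ℂ (φ p) (ψ q) =
      (if p.2 = q.2 then κ else 0) * ∫ x, (starRingEnd ℂ) (ε p.1 x) * ε q.1 x ∂μ := by
  rw [inner_eq_integral_modulatedSum hω hν hφ, ← integral_const_mul]
  refine integral_congr_ae ?_
  filter_upwards [ae_all_iff.mpr (hψ q), hmm' p.2 q.2] with x hx hx'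
  rw [← hx', Finset.sum_mul, modulatedSum, Finset.mul_sum]
  refine Finset.sum_congr rfl fun r _ => ?_
  rw [hx]; ring

/-- Parseval forces `modulatedSum ω (m s) f` to vanish a.e. for every `s`. Pointwise this is a
linear system for the values `f (ω r x)`, and `m'` supplies a left inverse up to `κ`. -/
theorem eq_zero_of_inner_modulated_eq_zero (hω : ∀ r, AEMeasurable (ω r) μ)
    (hν : ν = Measure.sum fun r => μ.map (ω r)) {m' : Fin k → Fin k → X → ℂ} {κ : ℂ}
    (hε : ∀ h : X → ℂ, MemLp h 2 μ →
      HasSum (fun n => ‖∫ x, (starRingEnd ℂ) (ε n x) * h x ∂μ‖ ^ 2) (c * ∫ x, ‖h x‖ ^ 2 ∂μ))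
    (hc : c ≠ 0) (hφ : ∀ p r, ∀ᵐ x ∂μ, φ p (ω r x) = ε p.1 x * m p.2 r x)
    (hm : ∀ s r, AEStronglyMeasurable (m s r) μ) (hmC : ∀ s r, ∀ᵐ x ∂μ, ‖m s r x‖ ≤ C)
    (hκ : κ ≠ 0) (hmm' : ∀ r r', ∀ᵐ x ∂μ,
      ∑ s, (starRingEnd ℂ) (m s r x) * m' s r' x = if r = r' then κ else 0)
    (f : Lp ℂ 2 ν) (hf : ∀ p, inner ℂ (φ p) f = 0) : f = 0 := by
  have h1 (s : Fin k) : ∀ᵐ x ∂μ, modulatedSum ω (m s) f x = 0 := by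
    have hmem := memLp_modulatedSum hω hν (hm s) (hmC s) f
    have h2 := hε _ hmem
    have h3 (n : N) : ∫ x, (starRingEnd ℂ) (ε n x) * modulatedSum ω (m s) f x ∂μ = 0 := by
      rw [← hf (n, s), inner_eq_integral_modulatedSum hω hν hφ]
    simp only [h3, norm_zero, ne_eq, OfNat.ofNat_ne_zero, not_false_eq_true, zero_pow] at h2
    have h4 := (mul_eq_zero.mp (h2.unique hasSum_zero)).resolve_left hc
    rw [integral_eq_zero_iff_of_nonneg (fun _ => by positivity)
      (hmem.integrable_norm_pow two_ne_zero)] at h4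
    filter_upwards [h4] with x hx
    simpa using hx
  have h2 (r : Fin k) : ∀ᵐ x ∂μ, f (ω r x) = 0 := by
    filter_upwards [ae_all_iff.mpr h1, ae_all_iff.mpr fun r' => hmm' r' r] with x hx hx'
    have h3 : ∑ s, m' s r x * modulatedSum ω (m s) f x = κ * f (ω r x) := by
      simp only [modulatedSum, Finset.mul_sum]
      rw [Finset.sum_comm]
      calc ∑ r', ∑ s, m' s r x * ((starRingEnd ℂ) (m s r' x) * f (ω r' x))
          = ∑ r', (∑ s, (starRingEnd ℂ) (m s r' x) * m' s r x) * f (ω r' x) := by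
            refine Finset.sum_congr rfl fun r' _ => ?_
            rw [Finset.sum_mul]
            exact Finset.sum_congr rfl fun s _ => by ring
        _ = κ * f (ω r x) := by simp [hx']
    simp only [hx, mul_zero, Finset.sum_const_zero] at h3
    exact (mul_eq_zero.mp h3.symm).resolve_left hκ
  have h3 := norm_sq_eq_sum_integral_comp hω hν f
  have h4 : ∑ r, ∫ x, ‖f (ω r x)‖ ^ 2 ∂μ = 0 := by
    refine Finset.sum_eq_zero fun r _ => integral_eq_zero_of_ae ?_
    filter_upwards [h2 r] with x hx
    simp [hx]
  rw [h4] at h3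
  simpa using h3

end Modulation

/-! ### From singular values to bounds on the inverse matrix. -/

section SingularValues

/-- In an orthonormal eigenbasis of `T*T`, `‖T v‖² = ∑ σ_i² |v_i|²`. -/
theorem LinearMap.mul_norm_le_of_le_singularValues {E F : Type*} [NormedAddCommGroup E]
    [InnerProductSpace ℂ E] [FiniteDimensional ℂ E] [NormedAddCommGroup F] [InnerProductSpace ℂ F]
    [FiniteDimensional ℂ F] (T : E →ₗ[ℂ] F) {n : ℕ} (hn : Module.finrank ℂ E = n) {α : ℝ}
    (hα : 0 ≤ α) (h : ∀ i : Fin n, α ≤ T.singularValues i) (v : E) : α * ‖v‖ ≤ ‖T v‖ := by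
  have hT := T.isSymmetric_adjoint_comp_self
  set b := hT.eigenvectorBasis hn
  have h1 : ‖T v‖ ^ 2 = ∑ i, hT.eigenvalues hn i * ‖b.repr v i‖ ^ 2 := by
    have h2 : inner ℂ v ((LinearMap.adjoint T ∘ₗ T) v) = ((‖T v‖ ^ 2 : ℝ) : ℂ) := by
      rw [LinearMap.comp_apply, LinearMap.adjoint_inner_right, inner_self_eq_norm_sq_to_K]
      simp
    rw [← b.repr.inner_map_map, PiLp.inner_apply] at h2
    refine Complex.ofReal_injective (h2.symm.trans ?_)
    rw [Complex.ofReal_sum]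
    refine Finset.sum_congr rfl fun i _ => ?_
    rw [hT.eigenvectorBasis_apply_self_apply hn, RCLike.inner_apply, mul_assoc, RCLike.mul_conj]
    simp [b]
  have h2 : ‖v‖ ^ 2 = ∑ i, ‖b.repr v i‖ ^ 2 := by
    rw [← b.repr.norm_map, EuclideanSpace.norm_sq_eq]
  refine le_of_sq_le_sq ?_ (norm_nonneg _)
  rw [mul_pow, h1, h2, Finset.mul_sum]
  gcongr with i _
  rw [← T.sq_singularValues_fin hn]
  gcongr
  exact h i

/-- The bound `α ‖v‖ ≤ ‖A v‖` gives injectivity; applied to the column `A⁻¹ e_s`, whose image is the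
unit vector `e_s`, it bounds that column by `α⁻¹`. -/
theorem Matrix.isUnit_det_and_norm_inv_apply_le {k : ℕ} (A : Matrix (Fin k) (Fin k) ℂ) {α : ℝ}
    (hα : 0 < α) (h : ∀ i : Fin k, α < (Matrix.toEuclideanLin A).singularValues i) :
    IsUnit A.det ∧ ∀ r s, ‖A⁻¹ r s‖ ≤ α⁻¹ := by
  have hb := (Matrix.toEuclideanLin A).mul_norm_le_of_le_singularValues (n := k) (by simp) hα.le
    fun i => (h i).le
  have hdet : A.det ≠ 0 := by
    intro h0
    obtain ⟨v, hv, hAv⟩ := Matrix.exists_mulVec_eq_zero_iff.mpr h0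
    have h1 := hb (WithLp.toLp 2 v)
    rw [Matrix.toLpLin_toLp, Matrix.toLin'_apply, hAv, WithLp.toLp_zero, norm_zero] at h1
    have h2 : ‖(WithLp.toLp 2 v : EuclideanSpace ℂ (Fin k))‖ ≤ 0 := by
      by_contra! h3
      nlinarith
    refine hv ?_
    simpa using h2
  refine ⟨hdet.isUnit, fun r s => ?_⟩
  have h1 := hb (WithLp.toLp 2 (A⁻¹ *ᵥ Pi.single s 1))
  rw [Matrix.toLpLin_toLp, Matrix.toLin'_apply, Matrix.mulVec_mulVec,
    Matrix.mul_nonsing_inv _ hdet.isUnit, Matrix.one_mulVec] at h1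
  have h2 : ‖(WithLp.toLp 2 (Pi.single s 1 : Fin k → ℂ) : EuclideanSpace ℂ (Fin k))‖ = 1 := by
    simp
  have h3 := PiLp.norm_apply_le (WithLp.toLp 2 (A⁻¹ *ᵥ Pi.single s 1) : EuclideanSpace ℂ (Fin k)) r
  rw [h2] at h1
  have h4 : (WithLp.toLp 2 (A⁻¹ *ᵥ Pi.single s 1) : EuclideanSpace ℂ (Fin k)) r = A⁻¹ r s := by
    simp
  rw [h4] at h3
  refine h3.trans ?_
  rwa [← one_div α, le_div_iff₀' hα]

end SingularValues

/-! ### Exponentials and dual functions pulled back along `ω`. -/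

section Exponentials

variable {d : ℕ}

theorem expFun_add_left (u v x : EuclideanSpace ℝ (Fin d)) :
    expFun (u + v) x = expFun u x * expFun v x := by
  simp only [expFun, inner_add_left, Complex.ofReal_add, mul_add, Complex.exp_add]

theorem expFun_add_right (u x y : EuclideanSpace ℝ (Fin d)) :
    expFun u (x + y) = expFun u x * expFun u y := by
  simp only [expFun, inner_add_right, Complex.ofReal_add, mul_add, Complex.exp_add]

theorem norm_expFun (u x : EuclideanSpace ℝ (Fin d)) : ‖expFun u x‖ = 1 := by
  have h : 2 * Real.pi * Complex.I * (inner ℝ u x : ℝ) =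
      ((2 * Real.pi * inner ℝ u x : ℝ) : ℂ) * Complex.I := by
    push_cast; ring
  rw [expFun, h, Complex.norm_exp_ofReal_mul_I]

theorem conj_expFun_mul_self (u x : EuclideanSpace ℝ (Fin d)) :
    (starRingEnd ℂ) (expFun u x) * expFun u x = 1 := by
  rw [RCLike.conj_mul, norm_expFun]; simp

theorem conj_expFun (u x : EuclideanSpace ℝ (Fin d)) :
    (starRingEnd ℂ) (expFun u x) = expFun (-u) x := by
  rw [expFun, expFun, ← Complex.exp_conj]
  simp [Complex.conj_ofNat]

@[fun_prop]
theorem continuous_expFun (u : EuclideanSpace ℝ (Fin d)) : Continuous (expFun u) := by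
  unfold expFun; fun_prop

variable {M : Matrix (Fin d) (Fin d) ℝ}

/-- `M^{-T} n · M z = n · z` is an integer; this is the `Λ`-periodicity of the exponentials of `Λ*`.
-/
theorem expFun_dualPoint_of_mem (hM : M.det ≠ 0) (n : Fin d → ℤ) {l : EuclideanSpace ℝ (Fin d)}
    (hl : l ∈ lattice M) : expFun (dualPoint M n) l = 1 := by
  obtain ⟨z, rfl⟩ := hl
  beta_reduce
  rw [← cellEquiv_apply M hM, expFun_dualPoint_cellEquiv, Complex.exp_eq_one_iff]
  refine ⟨∑ i, n i * z i, ?_⟩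
  simp only [dotProduct]
  push_cast
  ring

theorem integral_conj_expFun_mul_expFun (hM : M.det ≠ 0) (n n' : Fin d → ℤ) :
    ∫ x in fundCell M, (starRingEnd ℂ) (expFun (dualPoint M n) x) * expFun (dualPoint M n') x =
      if n = n' then ((|M.det| : ℝ) : ℂ) else 0 := by
  have h (x : EuclideanSpace ℝ (Fin d)) :
      (starRingEnd ℂ) (expFun (dualPoint M n) x) * expFun (dualPoint M n') x =
        expFun (dualPoint M (n' - n)) x := by
    have h1 : -dualPoint M n + dualPoint M n' = dualPoint M (n' - n) := by
      have h2 : (fun i => (((n' - n) i : ℤ) : ℝ)) = (fun i => (n' i : ℝ)) - fun i => (n i : ℝ) := by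
        ext; simp
      rw [dualPoint, dualPoint, dualPoint, h2, Matrix.mulVec_sub, WithLp.toLp_sub]
      abel
    rw [conj_expFun, ← expFun_add_left, h1]
  simp only [h, integral_expFun_fundCell M hM, sub_eq_zero, eq_comm]

variable {k : ℕ} {P : Fin k → Set (EuclideanSpace ℝ (Fin d))} {a : Fin k → EuclideanSpace ℝ (Fin d)}

theorem matV_apply (x : EuclideanSpace ℝ (Fin d)) (s r : Fin k) :
    matV M P a x s r = (starRingEnd ℂ) (expFun (a s) (latticePoint M (P r) x)) := by
  rw [conj_expFun, matV, Matrix.of_apply, expFun, inner_neg_left, real_inner_comm]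
  push_cast
  ring_nf

theorem norm_matV_apply (x : EuclideanSpace ℝ (Fin d)) (s r : Fin k) :
    ‖matV M P a x s r‖ = 1 := by
  rw [matV_apply, RCLike.norm_conj, norm_expFun]

theorem expFun_omega (hM : M.det ≠ 0) (n : Fin d → ℤ) (s r : Fin k)
    (x : EuclideanSpace ℝ (Fin d)) :
    expFun (dualPoint M n + a s) (omega M (P r) x) =
      expFun (dualPoint M n) x * (expFun (a s) x * (starRingEnd ℂ) (matV M P a x s r)) := by
  rw [matV_apply, Complex.conj_conj, omega, expFun_add_left, expFun_add_right, expFun_add_right,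
    expFun_dualPoint_of_mem hM n (latticePoint_mem M _ x), mul_one]

/-- On `Ω_r` only the `r`-th summand survives, and its factor `V_{sr}` cancels the phase `conj
V_{sr}` that `e_{a_s}` acquires under translation by `λ_r(x)`. -/
theorem dualFun_omega (hM : M.det ≠ 0) (hP : Pairwise fun r r' => Disjoint (P r) (P r'))
    (n : Fin d → ℤ) (s r : Fin k) {x : EuclideanSpace ℝ (Fin d)} (hx : x ∈ fundCell M)
    (hxr : ∃! l : lattice M, x + (l : EuclideanSpace ℝ (Fin d)) ∈ P r) :
    dualFun M P a (dualPoint M n) s (omega M (P r) x) =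
      expFun (dualPoint M n) x * (k * expFun (a s) x * (matV M P a x)⁻¹ r s) := by
  have hmem : omega M (P r) x ∈ P r := omega_mem hxr
  rw [dualFun, Finset.sum_eq_single r, Set.indicator_of_mem hmem, omegaInv_omega hM _ hx,
    expFun_omega hM]
  · have h : (starRingEnd ℂ) (matV M P a x s r) * matV M P a x s r = 1 := by
      rw [RCLike.conj_mul, norm_matV_apply]; simp
    linear_combination (expFun (dualPoint M n) x * expFun (a s) x * k *
      (matV M P a x)⁻¹ r s) * h
  · intro r' _ hr'
    rw [Set.indicator_of_notMem (Set.disjoint_left.mp (hP hr'.symm) hmem), mul_zero]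
  · simp

theorem continuous_matrix_conj_expFun (a : Fin k → EuclideanSpace ℝ (Fin d)) :
    Continuous fun l : Fin k → EuclideanSpace ℝ (Fin d) =>
      (Matrix.of fun s r => (starRingEnd ℂ) (expFun (a s) (l r)) : Matrix (Fin k) (Fin k) ℂ) := by
  refine continuous_matrix fun s r => ?_
  exact Complex.continuous_conj.comp ((continuous_expFun (a s)).comp (continuous_apply r))

theorem matV_eq (x : EuclideanSpace ℝ (Fin d)) :
    matV M P a x = Matrix.of fun s r =>
      (starRingEnd ℂ) (expFun (a s) ((fun r => latticePoint M (P r) x) r)) := by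
  ext s r; exact matV_apply x s r

theorem aestronglyMeasurable_matV
    (hP : ∀ r, IsAddFundamentalDomain (lattice M) (P r) volume) (s r : Fin k) :
    AEStronglyMeasurable (fun x => matV M P a x s r) volume := by
  simp only [matV_apply]
  exact (Complex.continuous_conj.comp (continuous_expFun (a s))).comp_aestronglyMeasurable
    (aemeasurable_latticePoint (hP r)).aestronglyMeasurable

/-- By Cramer's rule the entry is a measurable function of the lattice points; continuity may fail
where the determinant vanishes. -/
theorem aestronglyMeasurable_matV_inv
    (hP : ∀ r, IsAddFundamentalDomain (lattice M) (P r) volume) (s r : Fin k) :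
    AEStronglyMeasurable (fun x => (matV M P a x)⁻¹ s r) volume := by
  have hl : AEMeasurable (fun x => fun r => latticePoint M (P r) x) volume :=
    aemeasurable_pi_lambda _ fun r => aemeasurable_latticePoint (hP r)
  have hc := continuous_matrix_conj_expFun a
  have hmeas : Measurable fun l : Fin k → EuclideanSpace ℝ (Fin d) =>
      (Matrix.of fun s r => (starRingEnd ℂ) (expFun (a s) (l r)) :
        Matrix (Fin k) (Fin k) ℂ)⁻¹ s r := by
    simp only [Matrix.inv_def, Ring.inverse_eq_inv', Matrix.smul_apply, smul_eq_mul]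
    exact hc.matrix_det.measurable.inv.mul (hc.matrix_adjugate.matrix_elem s r).measurable
  have h := (hmeas.comp_aemeasurable hl).aestronglyMeasurable
  refine h.congr (.of_forall fun x => ?_)
  simp only [Function.comp_apply, matV_eq]

end Exponentials

/-! ### Assembling the biorthogonal Riesz bases. -/

section Main

variable {d k : ℕ} {M : Matrix (Fin d) (Fin d) ℝ} {Ω : Set (EuclideanSpace ℝ (Fin d))}
  {P : Fin k → Set (EuclideanSpace ℝ (Fin d))} {a : Fin k → EuclideanSpace ℝ (Fin d)}

theorem IsTilePartition.restrict_eq_sum_map (hM : M.det ≠ 0) (hP : IsTilePartition M Ω P) :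
    (volume.restrict Ω : Measure (EuclideanSpace ℝ (Fin d))) =
      Measure.sum fun r => (volume.restrict (fundCell M)).map (omega M (P r)) := by
  simp only [map_omega (isAddFundamentalDomain_fundCell hM) (hP.isAddFundamentalDomain _)]
  exact hP.restrict_eq_sum

theorem IsTilePartition.volume_eq (hM : M.det ≠ 0) (hP : IsTilePartition M Ω P) :
    volume Ω = k * ENNReal.ofReal |M.det| := by
  have h := congrArg (fun m => m Set.univ) hP.restrict_eq_sum
  simp only [Measure.restrict_apply_univ, Measure.sum_apply _ MeasurableSet.univ, tsum_fintype,
    fun r => (hP.isAddFundamentalDomain r).measure_eq (isAddFundamentalDomain_fundCell hM),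
    volume_fundCell M hM, Finset.sum_const, Finset.card_univ, Fintype.card_fin, nsmul_eq_mul] at h
  exact h

theorem memLp_expFun_restrict (hΩ : volume Ω < ∞) (u : EuclideanSpace ℝ (Fin d)) :
    MemLp (expFun u) 2 (volume.restrict Ω) := by
  have : IsFiniteMeasure (volume.restrict Ω) := ⟨by simpa using hΩ⟩
  exact .of_bound (continuous_expFun u).aestronglyMeasurable 1
    (.of_forall fun x => (norm_expFun u x).le)

theorem ae_dualFun_omega (hM : M.det ≠ 0) (hP : IsTilePartition M Ω P) (n : Fin d → ℤ)
    (s r : Fin k) : ∀ᵐ x ∂volume.restrict (fundCell M),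
      dualFun M P a (dualPoint M n) s (omega M (P r) x) =
        expFun (dualPoint M n) x * (k * expFun (a s) x * (matV M P a x)⁻¹ r s) := by
  filter_upwards [ae_restrict_mem (measurableSet_fundCell hM),
    ae_restrict_of_ae (ae_existsUnique_mem (hP.isAddFundamentalDomain r))] with x hx hxr
  exact dualFun_omega hM hP.pairwise_disjoint n s r hx hxr

/-- Each pullback to the cell is bounded by `k C`, and the cell has finite measure. -/
theorem memLp_dualFun (hM : M.det ≠ 0) (hP : IsTilePartition M Ω P) {C : ℝ}
    (hC : ∀ᵐ x ∂volume.restrict (fundCell M), ∀ r s, ‖(matV M P a x)⁻¹ r s‖ ≤ C)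
    (n : Fin d → ℤ) (s : Fin k) :
    MemLp (dualFun M P a (dualPoint M n) s) 2 (volume.restrict Ω) := by
  have hcell := isAddFundamentalDomain_fundCell hM
  have : IsFiniteMeasure (volume.restrict (fundCell M)) :=
    ⟨by rw [Measure.restrict_apply_univ, volume_fundCell M hM]; exact ENNReal.ofReal_lt_top⟩
  have hmem (r : Fin k) : MemLp (dualFun M P a (dualPoint M n) s ∘ omega M (P r)) 2
      (volume.restrict (fundCell M)) := by
    have h1 : MemLp (fun x => expFun (dualPoint M n) x *
        (k * expFun (a s) x * (matV M P a x)⁻¹ r s)) 2 (volume.restrict (fundCell M)) := by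
      refine .of_bound (C := k * C) ?_ ?_
      · exact (continuous_expFun _).aestronglyMeasurable.mul
          ((continuous_const.mul (continuous_expFun _)).aestronglyMeasurable.mul
            (aestronglyMeasurable_matV_inv hP.isAddFundamentalDomain r s).restrict)
      · filter_upwards [hC] with x hx
        simp only [norm_mul, norm_expFun, one_mul, mul_one, Complex.norm_natCast]
        gcongr
        exact hx r s
    refine (memLp_congr_ae ?_).mp h1
    filter_upwards [ae_dualFun_omega hM hP n s r] with x hx
    exact hx.symm
  refine memLp_of_comp_of_eq_sum_map
    (fun r => (aemeasurable_omega (hP.isAddFundamentalDomain r)).restrict)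
    (hP.restrict_eq_sum_map hM) (fun r => ?_) hmem
  rw [map_omega hcell (hP.isAddFundamentalDomain r)]
  exact aestronglyMeasurable_of_comp_omega hcell (hP.isAddFundamentalDomain r) (hmem r).1

theorem exists_dualPoint_eq {u : EuclideanSpace ℝ (Fin d)} (hu : u ∈ dualLattice M) :
    ∃ n, u = dualPoint M n := by
  obtain ⟨n, rfl⟩ := hu
  exact ⟨n, rfl⟩

theorem exists_biorthogonal_rieszBases (hM : M.det ≠ 0) (hΩ0 : 0 < volume Ω)
    (hP : IsTilePartition M Ω P) {C : ℝ}
    (hV : ∀ᵐ x ∂volume.restrict (fundCell M), IsUnit (matV M P a x).det)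
    (hC : ∀ᵐ x ∂volume.restrict (fundCell M), ∀ r s, ‖(matV M P a x)⁻¹ r s‖ ≤ C) :
    ∃ e g : freqSet M a → Lp ℂ 2 (volume.restrict Ω),
      (∀ l : freqSet M a, e l =ᵐ[volume.restrict Ω] expFun (l : EuclideanSpace ℝ (Fin d))) ∧
      (∀ (l : freqSet M a) (s : Fin k), ∀ u ∈ dualLattice M,
        (l : EuclideanSpace ℝ (Fin d)) = u + a s →
        g l =ᵐ[volume.restrict Ω] dualFun M P a u s) ∧
      IsRieszBasis e ∧ IsRieszBasis g ∧
      (∀ l : freqSet M a, inner ℂ (e l) (g l) = ((volume Ω).toReal : ℂ)) ∧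
      (∀ l l' : freqSet M a, l ≠ l' → inner ℂ (e l) (g l') = 0) := by
  have hvol := hP.volume_eq hM
  have hΩ : volume Ω < ∞ := by
    rw [hvol]; exact ENNReal.mul_lt_top (by simp) ENNReal.ofReal_lt_top
  have hk : (k : ℂ) ≠ 0 := by
    rintro h
    have h' : k = 0 := by exact_mod_cast h
    rw [hvol, h'] at hΩ0
    simp at hΩ0
  have hκ : (volume Ω).toReal ≠ 0 := (ENNReal.toReal_pos hΩ0.ne' hΩ.ne).ne'
  have hκ' : ((volume Ω).toReal : ℂ) = k * ((|M.det| : ℝ) : ℂ) := by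
    rw [hvol]; simp
  have hfd := hP.isAddFundamentalDomain
  set μ : Measure (EuclideanSpace ℝ (Fin d)) := volume.restrict (fundCell M)
  have hω (r : Fin k) : AEMeasurable (omega M (P r)) μ := (aemeasurable_omega (hfd r)).restrict
  have hν := hP.restrict_eq_sum_map hM
  let freq : (Fin d → ℤ) × Fin k → EuclideanSpace ℝ (Fin d) := fun p => dualPoint M p.1 + a p.2
  let E : EuclideanSpace ℝ (Fin d) → Lp ℂ 2 (volume.restrict Ω) := fun u =>
    (memLp_expFun_restrict hΩ u).toLp
  -- Indexed by pairs, since the formula depends on `s` and not just on the frequency; injectivity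
  -- of `freq` below lets the index descend to `L`.
  let G : (Fin d → ℤ) × Fin k → Lp ℂ 2 (volume.restrict Ω) := fun p =>
    (memLp_dualFun hM hP hC p.1 p.2).toLp
  let ε : (Fin d → ℤ) → EuclideanSpace ℝ (Fin d) → ℂ := fun n => expFun (dualPoint M n)
  let m : Fin k → Fin k → EuclideanSpace ℝ (Fin d) → ℂ := fun s r x =>
    expFun (a s) x * (starRingEnd ℂ) (matV M P a x s r)
  let m' : Fin k → Fin k → EuclideanSpace ℝ (Fin d) → ℂ := fun s r x =>
    k * expFun (a s) x * (matV M P a x)⁻¹ r s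
  have hpull {f h : EuclideanSpace ℝ (Fin d) → ℂ} (hfh : f =ᵐ[volume.restrict Ω] h) (r : Fin k) :
      ∀ᵐ x ∂μ, f (omega M (P r) x) = h (omega M (P r) x) :=
    ae_of_ae_map (hω r) (ae_mono (map_le_of_eq_sum hν r) hfh)
  have hE (p) (r : Fin k) : ∀ᵐ x ∂μ, (E (freq p)) (omega M (P r) x) = ε p.1 x * m p.2 r x := by
    filter_upwards [hpull (memLp_expFun_restrict hΩ (freq p)).coeFn_toLp r] with x hx
    exact hx.trans (expFun_omega hM p.1 p.2 r x)
  have hG (p) (r : Fin k) : ∀ᵐ x ∂μ, (G p) (omega M (P r) x) = ε p.1 x * m' p.2 r x := by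
    filter_upwards [hpull (memLp_dualFun hM hP hC p.1 p.2).coeFn_toLp r,
      ae_dualFun_omega hM hP p.1 p.2 r] with x hx hx'
    exact hx.trans hx'
  have hm (s r : Fin k) : AEStronglyMeasurable (m s r) μ :=
    (continuous_expFun _).aestronglyMeasurable.mul
      (Complex.continuous_conj.comp_aestronglyMeasurable (aestronglyMeasurable_matV hfd s r).restrict)
  have hm1 (s r : Fin k) : ∀ᵐ x ∂μ, ‖m s r x‖ ≤ 1 := .of_forall fun x => by
    simp only [m, norm_mul, norm_expFun, RCLike.norm_conj, norm_matV_apply, mul_one, le_refl]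
  have hm' (s r : Fin k) : AEStronglyMeasurable (m' s r) μ :=
    (continuous_const.mul (continuous_expFun _)).aestronglyMeasurable.mul
      (aestronglyMeasurable_matV_inv hfd r s).restrict
  have hm'C (s r : Fin k) : ∀ᵐ x ∂μ, ‖m' s r x‖ ≤ k * C := by
    filter_upwards [hC] with x hx
    simp only [m', norm_mul, norm_expFun, mul_one, Complex.norm_natCast]
    gcongr
    exact hx r s
  -- From `V V⁻¹ = 1`; the phase `conj(e_{a_s}) e_{a_{s'}}` is harmless, being `1` when `s = s'` and
  -- multiplied by `0` otherwise.
  have hrow (s s' : Fin k) : ∀ᵐ x ∂μ,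
      ∑ r, (starRingEnd ℂ) (m s r x) * m' s' r x = if s = s' then (k : ℂ) else 0 := by
    filter_upwards [hV] with x hx
    have h1 := congrFun (congrFun (Matrix.mul_nonsing_inv _ hx) s) s'
    rw [Matrix.mul_apply, Matrix.one_apply] at h1
    have h2 : ∑ r, (starRingEnd ℂ) (m s r x) * m' s' r x =
        k * ((starRingEnd ℂ) (expFun (a s) x) * expFun (a s') x) *
          ∑ r, matV M P a x s r * (matV M P a x)⁻¹ r s' := by
      rw [Finset.mul_sum]
      refine Finset.sum_congr rfl fun r _ => ?_
      simp only [m, m', map_mul, Complex.conj_conj]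
      ring
    rw [h2, h1]
    split_ifs with h
    · rw [h, conj_expFun_mul_self]; ring
    · ring
  -- From `V⁻¹ V = 1`; here the phases cancel within each summand.
  have hcol (r r' : Fin k) : ∀ᵐ x ∂μ,
      ∑ s, (starRingEnd ℂ) (m s r x) * m' s r' x = if r = r' then (k : ℂ) else 0 := by
    filter_upwards [hV] with x hx
    have h1 := congrFun (congrFun (Matrix.nonsing_inv_mul _ hx) r') r
    rw [Matrix.mul_apply, Matrix.one_apply] at h1
    have h2 : ∑ s, (starRingEnd ℂ) (m s r x) * m' s r' x =
        k * ∑ s, (matV M P a x)⁻¹ r' s * matV M P a x s r := by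
      rw [Finset.mul_sum]
      refine Finset.sum_congr rfl fun s _ => ?_
      simp only [m, m', map_mul, Complex.conj_conj]
      linear_combination (k * matV M P a x s r * (matV M P a x)⁻¹ r' s) *
        conj_expFun_mul_self (a s) x
    rw [h2, h1]
    simp [eq_comm]
  have hε (h : EuclideanSpace ℝ (Fin d) → ℂ) (hh : MemLp h 2 μ) := hasSum_fundCell M hM hh
  have hBE := isBesselWith_of_modulated hω hν hε (abs_nonneg _) hE hm hm1
  have hBG := isBesselWith_of_modulated hω hν hε (abs_nonneg _) hG hm' hm'C
  have hinner (p q : (Fin d → ℤ) × Fin k) :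
      inner ℂ (E (freq p)) (G q) = if p = q then ((volume Ω).toReal : ℂ) else 0 := by
    rw [inner_modulated hω hν hE hG hrow p q, integral_conj_expFun_mul_expFun hM, hκ']
    by_cases h2 : p.2 = q.2 <;> by_cases h1 : p.1 = q.1 <;> simp [h1, h2, Prod.ext_iff]
  have hcomplete (f : Lp ℂ 2 (volume.restrict Ω)) (hf : ∀ p, inner ℂ (E (freq p)) f = 0) : f = 0 :=
    eq_zero_of_inner_modulated_eq_zero hω hν hε (abs_ne_zero.mpr hM) hE hm hm1 hk hcol f hf
  -- The cosets `Λ* + a_s` are disjoint: if distinct pairs shared a frequency, one inner product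
  -- would equal both `0` and `|Ω|`.
  have hfreq : Function.Injective freq := by
    intro p q hpq
    by_contra h
    have h1 := hinner p q
    rw [hpq, hinner q q, if_pos rfl, if_neg h] at h1
    exact hκ (by exact_mod_cast h1)
  have hmem (p) : freq p ∈ freqSet M a :=
    Set.mem_iUnion.mpr ⟨p.2, dualPoint M p.1, ⟨p.1, rfl⟩, rfl⟩
  let σ : (Fin d → ℤ) × Fin k ≃ freqSet M a :=
    Equiv.ofBijective (fun p => ⟨freq p, hmem p⟩)
      ⟨fun p q h => hfreq (congrArg Subtype.val h), by
        rintro ⟨l, hl⟩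
        obtain ⟨s, u, hu, rfl⟩ := Set.mem_iUnion.mp hl
        obtain ⟨n, rfl⟩ := exists_dualPoint_eq hu
        exact ⟨(n, s), rfl⟩⟩
  have hσ (l : freqSet M a) : freq (σ.symm l) = l := congrArg Subtype.val (σ.apply_symm_apply l)
  have hR := isRieszBasis_of_biorthogonal hκ (hBE.comp_equiv σ.symm) (hBG.comp_equiv σ.symm)
    (fun l => by simp only [Function.comp_apply, hinner, if_true])
    (fun l l' h => by
      simp only [Function.comp_apply, hinner, if_neg (fun h' => h (σ.symm.injective h'))])
    (fun f hf => hcomplete f fun p => by simpa using hf (σ p))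
  refine ⟨_, _, fun l => ?_, fun l s u hu hl => ?_, hR.1, hR.2, fun l => ?_, fun l l' h => ?_⟩
  · have h := (memLp_expFun_restrict hΩ (freq (σ.symm l))).coeFn_toLp
    rw [hσ l] at h
    simp only [Function.comp_apply]
    rw [hσ l]
    exact h
  · obtain ⟨n, rfl⟩ := exists_dualPoint_eq hu
    have h1 : σ.symm l = (n, s) := hfreq ((hσ l).trans hl)
    simp only [Function.comp_apply, h1]
    exact (memLp_dualFun hM hP hC n s).coeFn_toLp
  · simp only [Function.comp_apply, hinner, if_true]
  · simp only [Function.comp_apply, hinner, if_neg (fun h' => h (σ.symm.injective h'))]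

end Main

theorem theorem1 {d k : ℕ} (M : Matrix (Fin d) (Fin d) ℝ) (hM : M.det ≠ 0)
    (Ω : Set (EuclideanSpace ℝ (Fin d))) (hΩ : IsKTile M k Ω) :
    (∃ P : Fin k → Set (EuclideanSpace ℝ (Fin d)), IsTilePartition M Ω P) ∧
    ∀ P : Fin k → Set (EuclideanSpace ℝ (Fin d)), IsTilePartition M Ω P →
    ∀ (a : Fin k → EuclideanSpace ℝ (Fin d)) (α β : ℝ), 0 < α →
    (∀ᵐ x ∂(volume.restrict (fundCell M)), ∀ i : Fin k,
      α < (Matrix.toEuclideanLin (matV M P a x)).singularValues i ∧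
      (Matrix.toEuclideanLin (matV M P a x)).singularValues i < β) →
    ∃ e g : freqSet M a → Lp ℂ 2 (volume.restrict Ω),
      (∀ l : freqSet M a, e l =ᵐ[volume.restrict Ω] expFun (l : EuclideanSpace ℝ (Fin d))) ∧
      (∀ (l : freqSet M a) (s : Fin k), ∀ u ∈ dualLattice M,
        (l : EuclideanSpace ℝ (Fin d)) = u + a s →
        g l =ᵐ[volume.restrict Ω] dualFun M P a u s) ∧
      IsRieszBasis e ∧ IsRieszBasis g ∧
      (∀ l : freqSet M a, inner ℂ (e l) (g l) = ((volume Ω).toReal : ℂ)) ∧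
      (∀ l l' : freqSet M a, l ≠ l' → inner ℂ (e l) (g l') = 0) := by
  refine ⟨hΩ.exists_isTilePartition M, fun P hP a α β hα hV => ?_⟩
  have h : ∀ᵐ x ∂(volume.restrict (fundCell M)), IsUnit (matV M P a x).det ∧
      ∀ r s, ‖(matV M P a x)⁻¹ r s‖ ≤ α⁻¹ := by
    filter_upwards [hV] with x hx
    exact (matV M P a x).isUnit_det_and_norm_inv_apply_le hα fun i => (hx i).1
  exact exists_biorthogonal_rieszBases hM hΩ.volume_pos hP (h.mono fun x hx => hx.1)
    (h.mono fun x hx => hx.2)
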